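/- For $n\ge 2$ let $\mathbb{B}^n=\{x\in\mathbb{R}^n : |x|<1\}$ and $\mathbb{H}^n=\{x\in\mathbb{R}^n : x_n>0\}$. For $G\in\{\mathbb{H}^n,\mathbb{B}^n\}$ and $x,y\in G$ put $$t_G(x,y)=\frac{|x-y|}{|x-y|+d_G(x)+d_G(y)},\qquad d_G(x)=\inf_{z\in\partial G}|x-z|.$$ A conformal mapping of $G_1$ onto $G_2$ is a continuously differentiable bijection $f:G_1\to G_2$ whose derivative at every point of $G_1$ is a nonzero multiple of a linear isometry. The Lipschitz constant of a map $f:G_1\to G_2$ for the $t$-metric is the least $L\ge 0$ such that $t_{G_2}(f(x),f(y))\le L\,t_{G_1}(x,y)$ for all $x,y\in G_1$. Let $n\ge 2$, let $G_1,G_2\in\{\mathbb{H}^n,\mathbb{B}^n\}$, and let $f$ be a conformal mapping of $G_1$ onto $G_2$. Then $$\tfrac12\,t_{G_1}(x,y)\le t_{G_2}(f(x),f(y))\le 2\,t_{G_1}(x,y)\qquad\text{for all }x,y\in G_1.$$ Consequently, the Lipschitz constant of $f$ for the $t$-metric exists and is at most $2$. Moreover, under the identification $\mathbb{R}^2=\mathbb{C}$,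 the Cayley map $h(z)=\dfrac{(1-z)\,i}{1+z}$ is a conformal mapping of $\mathbb{B}^2$ onto $\mathbb{H}^2$, and its Lipschitz constant for the $t$-metric is equal to $2$. -/

import Mathlib

noncomputable section

/-- The open unit ball `𝔹ⁿ` of Euclidean `n`-space. -/
def unitBall (n : ℕ) : Set (EuclideanSpace ℝ (Fin n)) :=
  Metric.ball 0 1

/-- The upper half-space `ℍⁿ`: the last coordinate (the one of index `n - 1`, counting from `0`)
is positive. -/
def upperHalfSpace (n : ℕ) : Set (EuclideanSpace ℝ (Fin n)) :=
  {x | ∀ i : Fin n, (i : ℕ) + 1 = n → 0 < x i}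

/-- The `t`-metric of a domain `G`:
`t_G(x, y) = |x - y| / (|x - y| + d_G(x) + d_G(y))`, where `d_G` is the distance to `∂G`. -/
def tMetric {X : Type*} [MetricSpace X] (G : Set X) (x y : X) : ℝ :=
  dist x y / (dist x y + Metric.infDist x (frontier G) + Metric.infDist y (frontier G))

/-- `f` is a conformal mapping of the open set `G₁` onto `G₂ = f(G₁)`: a continuously
differentiable bijection whose derivative at every point of `G₁` is a nonzero multiple of a linear
isometry (orientation may be preserved or reversed). -/
structure IsConformalMapping {n : ℕ}
    (f : EuclideanSpace ℝ (Fin n) → EuclideanSpace ℝ (Fin n))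
    (G₁ G₂ : Set (EuclideanSpace ℝ (Fin n))) : Prop where
  contDiffOn : ContDiffOn ℝ 1 f G₁
  conformalAt : ∀ x ∈ G₁, ConformalAt f x
  bijOn : Set.BijOn f G₁ G₂

/-- `L` is the Lipschitz constant `Lip(f|G₁)` of `f : G₁ → G₂` with respect to the `t`-metrics of
`G₁` and `G₂`, that is, the least admissible constant. -/
def IsTLipschitzConstant {X Y : Type*} [MetricSpace X] [MetricSpace Y]
    (f : X → Y) (G₁ : Set X) (G₂ : Set Y) (L : ℝ) : Prop :=
  IsLeast {C : ℝ | 0 ≤ C ∧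
    ∀ x ∈ G₁, ∀ y ∈ G₁, tMetric G₂ (f x) (f y) ≤ C * tMetric G₁ x y} L

/-- The complex Cayley map `z ↦ (1 - z) i / (1 + z)`. -/
def cayleyComplex (z : ℂ) : ℂ :=
  (1 - z) * Complex.I / (1 + z)

/-- The Cayley map, as a map of `ℝ²`, with `(u, v)` identified with `u + i v`. -/
def cayleyMap (x : EuclideanSpace ℝ (Fin 2)) : EuclideanSpace ℝ (Fin 2) :=
  !₂[(cayleyComplex ⟨x 0, x 1⟩).re, (cayleyComplex ⟨x 0, x 1⟩).im]

end

/-! ### Conformal energy of `log ‖F‖` on annuli, and the resulting capacity comparison. -/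

section Capacity

open MeasureTheory Set Filter Topology Metric
open scoped ENNReal

variable {E : Type*} [NormedAddCommGroup E] [InnerProductSpace ℝ E]

/-! Both domains carry a hyperbolic metric `ρ`, which conformal mappings between them do not
increase, and `t ≤ tanh (ρ / 2) ≤ 2 t` on each domain. Hence `t(f x, f y) ≤ tanh (ρ(f x, f y) / 2) ≤
tanh (ρ(x, y) / 2) ≤ 2 t(x, y)`, and the lower bound is the same estimate for the inverse map.

The contraction of `ρ` is proved uniformly in `n ≥ 2`, without classifying the conformal maps. Let
`F` be a conformal self-map of the ball fixing `0`, with `l = ‖F'(0)‖`. The `n`-energy of `log ‖F‖`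
over an annulus is bounded below by Bernoulli's inequality along radii (`energy_ge`) and above by a
change of variables (`energy_le`). For a small inner radius the two bounds give `log l ≤ n log l`
(`log_le_finrank_mul_log_of_conformal`), so `l ≥ 1`; the inverse map gives `l ≤ 1`. Conjugation by
explicit isometries carries `l ≤ 1` to every point (`IsHypModel.norm_fderiv_mul_le`), and
integration along radii yields the Schwarz–Pick inequality `IsHypModel.hypRatio_le`.

The comparison of `t` with `tanh (ρ / 2)` is elementary algebra; its delicate part is
`add_sq_le_four_mul_of_ball`. For the Cayley map the pairs `0, y` with real `y → 0+` show that `2`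
cannot be lowered. -/

theorem hasDerivAt_half_log_norm_sq {u : ℝ → E} {u' : E} {t : ℝ} (hu : HasDerivAt u u' t)
    (h0 : u t ≠ 0) :
    HasDerivAt (fun s => Real.log (‖u s‖ ^ 2) / 2) (inner ℝ (u t) u' / ‖u t‖ ^ 2) t := by
  have h := (hu.norm_sq.log (by positivity)).div_const 2
  refine h.congr_deriv ?_
  field_simp

theorem inner_div_norm_sq_le {v w : E} : inner ℝ v w / ‖v‖ ^ 2 ≤ ‖w‖ / ‖v‖ := by
  rcases eq_or_ne v 0 with rfl | hv
  · simp
  rw [div_le_div_iff₀ (by positivity) (by positivity)]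
  nlinarith [real_inner_le_norm v w, norm_pos_iff.2 hv]

theorem hasDerivAt_comp_smul {F : E → E} {x : E} {t : ℝ}
    (hF : DifferentiableAt ℝ F (t • x)) :
    HasDerivAt (fun s : ℝ => F (s • x)) (fderiv ℝ F (t • x) x) t := by
  have h1 : HasDerivAt (fun s : ℝ => s • x) x t := by
    simpa using (hasDerivAt_id t).smul_const x
  exact hF.hasFDerivAt.comp_hasDerivAt t h1

/-- Lower bound for the `d`-energy of `log ‖F‖` along a radius. -/
theorem radial_energy_ge {F : E → E} (hF : ContDiffOn ℝ 1 F (ball 0 1)) {d : ℕ} (hd : 1 ≤ d)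
    {θ : E} (hθ : ‖θ‖ = 1) {r R b M : ℝ} (hr : 0 < r) (hrR : r ≤ R) (hR : R < 1) (hM : 0 < M)
    (h0 : ∀ x ∈ ball (0 : E) 1, x ≠ 0 → F x ≠ 0) (hFr : ‖F (r • θ)‖ ≤ b * r)
    (hFR : M ≤ ‖F (R • θ)‖) :
    d * (Real.log M - Real.log (b * r)) - (d - 1) * (Real.log R - Real.log r) ≤
      ∫ t in r..R, t ^ (d - 1) * (‖fderiv ℝ F (t • θ)‖ / ‖F (t • θ)‖) ^ d := by
  have hθ0 : θ ≠ 0 := by rintro rfl; simp at hθ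
  have hmem : ∀ t ∈ Icc r R, t • θ ∈ ball (0 : E) 1 := by
    intro t ht
    have : 0 < t := hr.trans_le ht.1
    rw [mem_ball_zero_iff, norm_smul, hθ, mul_one, Real.norm_eq_abs, abs_of_pos this]
    exact ht.2.trans_lt hR
  have hne : ∀ t ∈ Icc r R, F (t • θ) ≠ 0 := fun t ht =>
    h0 _ (hmem t ht) (smul_ne_zero (hr.trans_le ht.1).ne' hθ0)
  have hdiff : ∀ t ∈ Icc r R, DifferentiableAt ℝ F (t • θ) := fun t ht =>
    (hF.differentiableOn one_ne_zero).differentiableAt (isOpen_ball.mem_nhds (hmem t ht))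
  have hc0 : ContinuousOn (fun t : ℝ => F (t • θ)) (Icc r R) :=
    hF.continuousOn.comp (by fun_prop) hmem
  have hc1 : ContinuousOn (fun t : ℝ => fderiv ℝ F (t • θ)) (Icc r R) :=
    (hF.continuousOn_fderiv_of_isOpen isOpen_ball le_rfl).comp (by fun_prop) hmem
  -- The increment of `Φ` over `[r, R]` dominates the left-hand side, and `Φ'` lies below the
  -- integrand. The log of the squared norm avoids differentiating the norm itself.
  set Φ : ℝ → ℝ := fun t => d * (Real.log (‖F (t • θ)‖ ^ 2) / 2) - (d - 1) * Real.log t with hΦ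
  have hderiv : ∀ t ∈ Icc r R, HasDerivAt Φ
      (d * (inner ℝ (F (t • θ)) (fderiv ℝ F (t • θ) θ) / ‖F (t • θ)‖ ^ 2) - (d - 1) * t⁻¹) t :=
    fun t ht =>
    ((hasDerivAt_half_log_norm_sq (hasDerivAt_comp_smul (hdiff t ht)) (hne t ht)).const_mul _).sub
      ((Real.hasDerivAt_log (hr.trans_le ht.1).ne').const_mul _)
  have key := intervalIntegral.sub_le_integral_of_hasDeriv_right_of_le (g := Φ)
    (φ := fun t => t ^ (d - 1) * (‖fderiv ℝ F (t • θ)‖ / ‖F (t • θ)‖) ^ d) hrR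
    (fun t ht => (hderiv t ht).continuousAt.continuousWithinAt)
    (fun t ht => (hderiv t (Ioo_subset_Icc_self ht)).hasDerivWithinAt)
    (ContinuousOn.integrableOn_Icc ((continuousOn_id.pow _).mul
      ((hc1.norm.div hc0.norm fun t ht => norm_ne_zero_iff.2 (hne t ht)).pow _)))
    (fun t ht => ?_)
  · refine le_trans ?_ key
    have e : ∀ t : ℝ, Real.log (‖F (t • θ)‖ ^ 2) / 2 = Real.log ‖F (t • θ)‖ := fun t => by
      rw [Real.log_pow]; push_cast; ring
    simp only [hΦ, e]
    have h1 : Real.log M ≤ Real.log ‖F (R • θ)‖ := Real.log_le_log hM hFR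
    have h2 : Real.log ‖F (r • θ)‖ ≤ Real.log (b * r) :=
      Real.log_le_log (norm_pos_iff.2 (hne r ⟨le_rfl, hrR⟩)) hFr
    have h3 : (0 : ℝ) ≤ d := by positivity
    nlinarith
  · have ht' := Ioo_subset_Icc_self ht
    have tpos : 0 < t := hr.trans_le ht'.1
    set q := ‖fderiv ℝ F (t • θ)‖ / ‖F (t • θ)‖ with hq
    have hq0 : 0 ≤ q := by positivity
    have h1 : inner ℝ (F (t • θ)) (fderiv ℝ F (t • θ) θ) / ‖F (t • θ)‖ ^ 2 ≤ q := by
      refine inner_div_norm_sq_le.trans ?_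
      rw [hq]
      gcongr
      simpa [hθ] using (fderiv ℝ F (t • θ)).le_opNorm θ
    -- Bernoulli at `t * q`, which equals `1` when `F` is the identity; so nothing is lost in that
    -- case.
    have h2 : 1 + d * (t * q - 1) ≤ (t * q) ^ d := by
      have := one_add_mul_le_pow (a := t * q - 1) (by nlinarith [mul_nonneg tpos.le hq0]) d
      simpa using this
    obtain ⟨m, rfl⟩ : ∃ m, d = m + 1 := ⟨d - 1, by omega⟩
    have h3 : t ^ (m + 1 - 1) * q ^ (m + 1) = (t * q) ^ (m + 1) / t := by
      rw [Nat.add_sub_cancel]; field_simp; ring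
    rw [h3]
    have h4 : (1 + ((m + 1 : ℕ) : ℝ) * (t * q - 1)) / t ≤ (t * q) ^ (m + 1) / t := by gcongr
    refine le_trans ?_ h4
    have h5 : (1 + ((m + 1 : ℕ) : ℝ) * (t * q - 1)) / t =
        ((m + 1 : ℕ) : ℝ) * q - (((m + 1 : ℕ) : ℝ) - 1) * t⁻¹ := by
      field_simp; ring
    rw [h5]
    gcongr

variable [FiniteDimensional ℝ E]

/-- Integration in polar coordinates. -/
theorem lintegral_eq_lintegral_toSphere [MeasurableSpace E] [BorelSpace E] [Nontrivial E]
    (μ : Measure E) [μ.IsAddHaarMeasure] {f : E → ℝ≥0∞} (hf : Measurable f) :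
    ∫⁻ x, f x ∂μ = ∫⁻ θ, (∫⁻ t in Ioi (0 : ℝ),
      ENNReal.ofReal (t ^ (Module.finrank ℝ E - 1)) * f (t • (θ : E))) ∂μ.toSphere := by
  have hmeas : Measurable fun p : sphere (0 : E) 1 × Ioi (0 : ℝ) => f ((p.2 : ℝ) • (p.1 : E)) :=
    hf.comp (by fun_prop)
  calc ∫⁻ x, f x ∂μ = ∫⁻ x : ({(0)}ᶜ : Set E), f x ∂(μ.comap (↑)) := by
        rw [lintegral_subtype_comap (measurableSet_singleton _).compl, restrict_compl_singleton]
    _ = ∫⁻ p, f ((p.2 : ℝ) • (p.1 : E))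
          ∂(μ.toSphere.prod (.volumeIoiPow (Module.finrank ℝ E - 1))) := by
        rw [← μ.measurePreserving_homeomorphUnitSphereProd.lintegral_comp hmeas]
        refine lintegral_congr fun x => ?_
        have hx : ‖(x : E)‖ ≠ 0 := norm_ne_zero_iff.2 x.2
        simp [smul_smul, hx]
    _ = ∫⁻ θ, (∫⁻ t, f ((t : ℝ) • (θ : E)) ∂(.volumeIoiPow (Module.finrank ℝ E - 1)))
          ∂μ.toSphere := lintegral_prod _ hmeas.aemeasurable
    _ = _ := by
        refine lintegral_congr fun θ => ?_
        have hθ : Measurable fun t : Ioi (0 : ℝ) => f ((t : ℝ) • (θ : E)) :=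
          hf.comp (by fun_prop)
        rw [Measure.volumeIoiPow, lintegral_withDensity_eq_lintegral_mul _ (by fun_prop) hθ,
          ← lintegral_subtype_comap measurableSet_Ioi]
        rfl

/-- In polar coordinates the Jacobian `t ^ (d - 1)` against `t ^ (-d)` leaves `dt / t` on each ray.
-/
theorem lintegral_annulus_norm_rpow [MeasurableSpace E] [BorelSpace E] [Nontrivial E]
    (μ : Measure E) [μ.IsAddHaarMeasure] {s : ℝ} (hs : 0 < s) (hs1 : s ≤ 1) :
    ∫⁻ x in {x : E | s ≤ ‖x‖ ∧ ‖x‖ < 1}, ENNReal.ofReal ((‖x‖ ^ Module.finrank ℝ E)⁻¹) ∂μ =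
      ENNReal.ofReal (Real.log s⁻¹) * μ.toSphere univ := by
  have hA : MeasurableSet {x : E | s ≤ ‖x‖ ∧ ‖x‖ < 1} :=
    (measurableSet_le measurable_const measurable_norm).inter
      (measurableSet_lt measurable_norm measurable_const)
  rw [← lintegral_indicator hA, lintegral_eq_lintegral_toSphere μ
    (Measurable.indicator (by fun_prop) hA), ← lintegral_const]
  refine lintegral_congr fun θ => ?_
  have hθ : ‖(θ : E)‖ = 1 := by simp
  have hd : 0 < Module.finrank ℝ E := Module.finrank_pos
  have key : ∀ t ∈ Ioi (0 : ℝ), ENNReal.ofReal (t ^ (Module.finrank ℝ E - 1)) *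
      {x : E | s ≤ ‖x‖ ∧ ‖x‖ < 1}.indicator
        (fun x => ENNReal.ofReal ((‖x‖ ^ Module.finrank ℝ E)⁻¹)) (t • (θ : E)) =
      (Ico s 1).indicator (fun t => ENNReal.ofReal t⁻¹) t := by
    intro t ht
    have ht : 0 < t := ht
    have hn : ‖t • (θ : E)‖ = t := by simp [norm_smul, abs_of_pos ht]
    by_cases h : t ∈ Ico s 1
    · rw [indicator_of_mem h, indicator_of_mem (by rw [mem_ofPred_eq, hn]; exact h), hn,
        ← ENNReal.ofReal_mul (by positivity)]
      congr 1
      obtain ⟨m, hm⟩ : ∃ m, Module.finrank ℝ E = m + 1 := ⟨_, (Nat.succ_pred_eq_of_pos hd).symm⟩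
      rw [hm, Nat.add_sub_cancel, pow_succ]
      field_simp
    · rw [indicator_of_notMem h, indicator_of_notMem (by rw [mem_ofPred_eq, hn]; exact h), mul_zero]
  rw [setLIntegral_congr_fun measurableSet_Ioi key, lintegral_indicator measurableSet_Ico,
    Measure.restrict_restrict measurableSet_Ico,
    inter_eq_left.2 (show Ico s 1 ⊆ Ioi 0 from fun t ht => lt_of_lt_of_le hs ht.1), Measure.restrict_congr_set Ico_ae_eq_Ioc,
    ← ofReal_integral_eq_lintegral_ofReal, ← intervalIntegral.integral_of_le hs1,
    integral_inv_of_pos hs one_pos, one_div]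
  · refine (ContinuousOn.integrableOn_Icc ?_).mono_set Ioc_subset_Icc_self
    exact continuousOn_id.inv₀ fun x hx => (hs.trans_le hx.1).ne'
  · filter_upwards [ae_restrict_mem measurableSet_Ioc] with y hy
    exact inv_nonneg.2 (hs.trans hy.1).le

/-- The determinant of a conformal linear map. -/
theorem IsConformalMap.abs_det_eq {A : E →L[ℝ] E} (hA : IsConformalMap A) :
    |A.det| = ‖A‖ ^ Module.finrank ℝ E := by
  rcases subsingleton_or_nontrivial E with hE | hE
  · have : A = 1 := by ext x; exact Subsingleton.elim _ _
    subst this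
    simp [ContinuousLinearMap.det, Module.finrank_zero_of_subsingleton]
  obtain ⟨c, hc, li, rfl⟩ := hA
  have h1 : ‖c • li.toContinuousLinearMap‖ = |c| := by
    rw [norm_smul, li.norm_toContinuousLinearMap, mul_one, Real.norm_eq_abs]
  have h2 : |LinearMap.det (li.toLinearMap)| = 1 := by
    have := LinearMap.normDet_eq_abs_det li.toLinearMap
    rw [← this]
    simp
  have h3 : (c • li.toContinuousLinearMap).det = c ^ Module.finrank ℝ E * LinearMap.det (li.toLinearMap) := by
    rw [ContinuousLinearMap.det]
    exact LinearMap.det_smul c li.toLinearMap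
  rw [h1, h3, abs_mul, h2, abs_pow, mul_one]

/-- Upper bound for the energy of `log ‖F‖` over an annulus, by change of variables. -/
theorem energy_le [MeasurableSpace E] [BorelSpace E] [Nontrivial E]
    (μ : Measure E) [μ.IsAddHaarMeasure] {F : E → E}
    (hc : ∀ x ∈ ball (0 : E) 1, ConformalAt F x) (hm : MapsTo F (ball 0 1) (ball 0 1))
    (hi : InjOn F (ball 0 1)) {A : Set E} (hA : MeasurableSet A) (hA1 : A ⊆ ball 0 1) {s : ℝ}
    (hs : 0 < s) (hs1 : s ≤ 1) (hAs : ∀ x ∈ A, s ≤ ‖F x‖) :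
    ∫⁻ x in A, ENNReal.ofReal ((‖fderiv ℝ F x‖ / ‖F x‖) ^ Module.finrank ℝ E) ∂μ ≤
      ENNReal.ofReal (Real.log s⁻¹) * μ.toSphere univ := by
  rw [← lintegral_annulus_norm_rpow μ hs hs1]
  calc _ = ∫⁻ x in A, ENNReal.ofReal |(fderiv ℝ F x).det| *
        ENNReal.ofReal ((‖F x‖ ^ Module.finrank ℝ E)⁻¹) ∂μ := by
        refine setLIntegral_congr_fun hA fun x hx => ?_
        rw [(conformalAt_iff_isConformalMap_fderiv.1 (hc x (hA1 hx))).abs_det_eq,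
          ← ENNReal.ofReal_mul (by positivity), div_pow, div_eq_mul_inv]
    _ = ∫⁻ y in F '' A, ENNReal.ofReal ((‖y‖ ^ Module.finrank ℝ E)⁻¹) ∂μ :=
        (lintegral_image_eq_lintegral_abs_det_fderiv_mul μ hA (fun x hx =>
          (hc x (hA1 hx)).differentiableAt.hasFDerivAt.hasFDerivWithinAt) (hi.mono hA1)
          (fun y => ENNReal.ofReal ((‖y‖ ^ Module.finrank ℝ E)⁻¹))).symm
    _ ≤ _ := by
        refine lintegral_mono_set ?_
        rintro _ ⟨x, hx, rfl⟩
        exact ⟨hAs x hx, mem_ball_zero_iff.1 (hm (hA1 hx))⟩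

/-- The bound of `radial_energy_ge` does not depend on the direction, so integrating it over the
sphere only multiplies it by the total spherical measure. -/
theorem energy_ge [MeasurableSpace E] [BorelSpace E] [Nontrivial E]
    (μ : Measure E) [μ.IsAddHaarMeasure] {F : E → E} (hF : ContDiffOn ℝ 1 F (ball 0 1))
    (h0 : ∀ x ∈ ball (0 : E) 1, x ≠ 0 → F x ≠ 0)
    {r R b M : ℝ} (hr : 0 < r) (hrR : r ≤ R) (hR : R < 1) (hM : 0 < M)
    (hFr : ∀ x : E, ‖x‖ = r → ‖F x‖ ≤ b * r) (hFR : ∀ x : E, ‖x‖ = R → M ≤ ‖F x‖) :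
    ENNReal.ofReal (Module.finrank ℝ E * (Real.log M - Real.log (b * r)) -
      (Module.finrank ℝ E - 1) * (Real.log R - Real.log r)) * μ.toSphere univ ≤
    ∫⁻ x in {x : E | r < ‖x‖ ∧ ‖x‖ ≤ R},
      ENNReal.ofReal ((‖fderiv ℝ F x‖ / ‖F x‖) ^ Module.finrank ℝ E) ∂μ := by
  set A : Set E := {x : E | r < ‖x‖ ∧ ‖x‖ ≤ R} with hAdef
  have hA : MeasurableSet A :=
    (measurableSet_lt measurable_const measurable_norm).inter
      (measurableSet_le measurable_norm measurable_const)
  have hAb : A ⊆ ball 0 1 := fun x hx => mem_ball_zero_iff.2 (hx.2.trans_lt hR)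
  have hA0 : ∀ x ∈ A, F x ≠ 0 := fun x hx =>
    h0 x (hAb hx) (norm_pos_iff.1 (hr.trans hx.1))
  have hq : ContinuousOn (fun x => (‖fderiv ℝ F x‖ / ‖F x‖) ^ Module.finrank ℝ E) A :=
    ((((hF.continuousOn_fderiv_of_isOpen isOpen_ball le_rfl).mono hAb).norm).div
      (hF.continuousOn.mono hAb).norm fun x hx => norm_ne_zero_iff.2 (hA0 x hx)).pow _
  have hmeas : Measurable (A.indicator fun x =>
      ENNReal.ofReal ((‖fderiv ℝ F x‖ / ‖F x‖) ^ Module.finrank ℝ E)) := by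
    have : (A.indicator fun x =>
      ENNReal.ofReal ((‖fderiv ℝ F x‖ / ‖F x‖) ^ Module.finrank ℝ E)) = fun x =>
        ENNReal.ofReal
        (A.piecewise (fun x => (‖fderiv ℝ F x‖ / ‖F x‖) ^ Module.finrank ℝ E) (fun _ => 0) x) := by
      funext x
      by_cases hx : x ∈ A <;> simp [hx]
    rw [this]
    exact (hq.measurable_piecewise continuousOn_const hA).ennreal_ofReal
  rw [← lintegral_indicator hA, lintegral_eq_lintegral_toSphere μ hmeas, ← lintegral_const]
  refine lintegral_mono fun θ => ?_
  have hθ : ‖(θ : E)‖ = 1 := by simp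
  have hn : ∀ t : ℝ, 0 ≤ t → ‖t • (θ : E)‖ = t := fun t ht => by
    simp [norm_smul, abs_of_nonneg ht]
  have hR0 : 0 < R := hr.trans_le hrR
  have key := radial_energy_ge hF (d := Module.finrank ℝ E) Module.finrank_pos hθ hr hrR hR hM h0
    (hFr _ (hn r hr.le)) (hFR _ (hn R hR0.le))
  refine (ENNReal.ofReal_le_ofReal key).trans ?_
  have hsub : Ioc r R ⊆ Ioi 0 := fun t ht => hr.trans ht.1
  rw [intervalIntegral.integral_of_le hrR, ofReal_integral_eq_lintegral_ofReal]
  · refine le_trans (le_of_eq ?_) (lintegral_mono_set hsub)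
    refine setLIntegral_congr_fun measurableSet_Ioc fun t ht => ?_
    have tpos : 0 < t := hr.trans ht.1
    have hmem : t • (θ : E) ∈ A := by
      rw [hAdef, mem_ofPred_eq, hn t tpos.le]; exact ht
    rw [indicator_of_mem hmem, ENNReal.ofReal_mul (by positivity)]
  · refine (ContinuousOn.integrableOn_Icc (a := r) (b := R) ?_).mono_set Ioc_subset_Icc_self
    have hmem : MapsTo (fun t : ℝ => t • (θ : E)) (Icc r R) (ball 0 1) := fun t ht => by
      rw [mem_ball_zero_iff, hn t (hr.le.trans ht.1)]; exact ht.2.trans_lt hR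
    refine (continuousOn_id.pow _).mul ((ContinuousOn.div
      ((hF.continuousOn_fderiv_of_isOpen isOpen_ball le_rfl).comp (by fun_prop) hmem).norm
      (hF.continuousOn.comp (by fun_prop) hmem).norm fun t ht => norm_ne_zero_iff.2 ?_).pow _)
    exact h0 _ (hmem ht) (smul_ne_zero (hr.trans_le ht.1).ne' (norm_ne_zero_iff.1 (by simp)))
  · filter_upwards [ae_restrict_mem measurableSet_Ioc] with t ht
    have tpos : 0 < t := hr.trans ht.1
    positivity

/-- Comparison of the conformal capacities of small balls and of their images. -/
theorem log_le_finrank_mul_log_of_conformal [Nontrivial E] {F g : E → E}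
    (hF : ContDiffOn ℝ 1 F (ball 0 1)) (hc : ∀ x ∈ ball (0 : E) 1, ConformalAt F x)
    (hm : MapsTo F (ball 0 1) (ball 0 1)) (hgm : MapsTo g (ball 0 1) (ball 0 1))
    (hg : ContinuousOn g (ball 0 1)) (hl : ∀ x ∈ ball (0 : E) 1, g (F x) = x)
    (hF0 : F 0 = 0) {a b : ℝ} (ha0 : 0 < a) (hb0 : 0 < b)
    (ha : ∀ᶠ x in 𝓝 0, a * ‖x‖ ≤ ‖F x‖) (hb : ∀ᶠ x in 𝓝 0, ‖F x‖ ≤ b * ‖x‖) :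
    Real.log a ≤ Module.finrank ℝ E * Real.log b := by
  let _ : MeasurableSpace E := borel E
  have : BorelSpace E := ⟨rfl⟩
  have mem0 : (0 : E) ∈ ball (0 : E) 1 := by simp
  have hg0 : g 0 = 0 := by simpa [hF0] using hl 0 mem0
  have hi : InjOn F (ball 0 1) := fun x hx y hy h => by rw [← hl x hx, h, hl y hy]
  have h0 : ∀ x ∈ ball (0 : E) 1, x ≠ 0 → F x ≠ 0 := fun x hx hx0 h =>
    hx0 (hi hx mem0 (h.trans hF0.symm))
  have hgc : Tendsto g (𝓝 0) (𝓝 0) := by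
    simpa [ContinuousAt, hg0] using hg.continuousAt (isOpen_ball.mem_nhds mem0)
  obtain ⟨η, hη, hη'⟩ := Metric.eventually_nhds_iff_ball.1 (hgc.eventually ha)
  obtain ⟨ρ, hρ, hρ'⟩ := Metric.eventually_nhds_iff_ball.1 hb
  obtain ⟨r, hr, hr1, hrη, hrρ, hra⟩ : ∃ r : ℝ, 0 < r ∧ r < 1 ∧ a * r < η ∧ r < ρ ∧ a * r < 1 := by
    have h1 : Tendsto (fun r : ℝ => a * r) (𝓝[>] 0) (𝓝 0) := by
      have : Tendsto (fun r : ℝ => a * r) (𝓝 0) (𝓝 (a * 0)) := by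
        exact (continuous_const.mul continuous_id).tendsto 0
      rw [mul_zero] at this
      exact this.mono_left nhdsWithin_le_nhds
    have h2 : Tendsto (fun r : ℝ => r) (𝓝[>] 0) (𝓝 0) := nhdsWithin_le_nhds
    have h3 : ∀ᶠ r : ℝ in 𝓝[>] 0, 0 < r := self_mem_nhdsWithin
    obtain ⟨r, h⟩ := (((h3.and
      (h2.eventually_lt_const one_pos)).and (h1.eventually_lt_const hη)).and
      ((h2.eventually_lt_const hρ).and (h1.eventually_lt_const one_pos))).exists
    exact ⟨r, h.1.1.1, h.1.1.2, h.1.2, h.2.1, h.2.2⟩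
  -- The bound by `a` is only local. Continuity of the inverse `g` at `0` makes it global: a point
  -- with image close to `0` is itself close to `0`.
  have hlow : ∀ x ∈ ball (0 : E) 1, r < ‖x‖ → a * r ≤ ‖F x‖ := by
    intro x hx hrx
    by_contra! h
    have h1 := hη' (F x) (mem_ball_zero_iff.2 (h.trans hrη))
    rw [hl x hx] at h1
    nlinarith
  have main : ∀ M ∈ Ioo (0 : ℝ) 1, Module.finrank ℝ E * (Real.log M - Real.log (b * r)) +
      (Module.finrank ℝ E - 1) * Real.log r ≤ Real.log (a * r)⁻¹ := by
    intro M hM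
    -- `F` is proper: the preimage of the closed ball of radius `M` is compact in the unit ball, and
    -- `R` is taken beyond it.
    obtain ⟨R, hrR, hR1, hFR⟩ : ∃ R, r ≤ R ∧ R < 1 ∧ ∀ x : E, ‖x‖ = R → M ≤ ‖F x‖ := by
      have hcomp : IsCompact (g '' closedBall 0 M) :=
        (isCompact_closedBall 0 M).image_of_continuousOn
          (hg.mono (closedBall_subset_ball hM.2))
      obtain ⟨z, hz, hzmax⟩ := hcomp.exists_isMaxOn
        ((nonempty_closedBall.2 hM.1.le).image g) continuous_norm.continuousOn
      have hz1 : ‖z‖ < 1 := by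
        obtain ⟨y, hy, rfl⟩ := hz
        exact mem_ball_zero_iff.1 (hgm (closedBall_subset_ball hM.2 hy))
      obtain ⟨R, hR, hR1⟩ := exists_between (max_lt hr1 hz1)
      refine ⟨R, ((le_max_left _ _).trans_lt hR).le, hR1, fun x hx => ?_⟩
      by_contra! h
      have h1 : ‖x‖ ≤ ‖z‖ := hzmax ⟨F x, mem_closedBall_zero_iff.2 h.le,
        hl x (mem_ball_zero_iff.2 (hx ▸ hR1))⟩
      have := (le_max_right r ‖z‖).trans_lt hR
      linarith
    have h1 := energy_ge Measure.addHaar hF h0 hr hrR hR1 hM.1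
      (fun x hx => hx ▸ hρ' x (mem_ball_zero_iff.2 (hx ▸ hrρ))) hFR
    have h2 := energy_le Measure.addHaar hc hm hi (A := {x : E | r < ‖x‖ ∧ ‖x‖ ≤ R})
      ((measurableSet_lt measurable_const measurable_norm).inter
        (measurableSet_le measurable_norm measurable_const))
      (fun x hx => mem_ball_zero_iff.2 (hx.2.trans_lt hR1)) (mul_pos ha0 hr) hra.le
      (fun x hx => hlow x (mem_ball_zero_iff.2 (hx.2.trans_lt hR1)) hx.1)
    have h3 := h1.trans h2
    rw [ENNReal.mul_le_mul_iff_left (Measure.measure_univ_ne_zero.2 (Measure.toSphere_ne_zero _)) (measure_ne_top _ _),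
      ENNReal.ofReal_le_ofReal_iff (Real.log_nonneg (by
        rw [one_le_inv₀ (mul_pos ha0 hr)]; exact hra.le))] at h3
    have h4 : Real.log R ≤ 0 := Real.log_nonpos (hr.le.trans hrR) hR1.le
    have h5 : (1 : ℝ) ≤ Module.finrank ℝ E := by exact_mod_cast (Module.finrank_pos : 0 < _)
    nlinarith
  have hlim : Tendsto (fun M => Module.finrank ℝ E * (Real.log M - Real.log (b * r)) +
      (Module.finrank ℝ E - 1) * Real.log r) (𝓝[<] 1)
      (𝓝 (Module.finrank ℝ E * (Real.log 1 - Real.log (b * r)) +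
      (Module.finrank ℝ E - 1) * Real.log r)) := by
    refine Tendsto.mono_left ?_ nhdsWithin_le_nhds
    exact (((Real.continuousAt_log one_ne_zero).tendsto.sub_const _).const_mul _).add_const _
  have h := le_of_tendsto hlim (by
    filter_upwards [Ioo_mem_nhdsLT (zero_lt_one (α := ℝ))] with M hM using main M hM)
  -- All terms in `log r` cancel, so no limit `r → 0` is needed.
  rw [Real.log_inv, Real.log_mul ha0.ne' hr.ne', Real.log_mul hb0.ne' hr.ne', Real.log_one] at h
  linarith

end Capacity
-- Composition and inversion of conformal mappings; the derivative at a fixed origin.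
section ConformalMaps

open MeasureTheory Set Filter Topology Metric
open scoped ENNReal

theorem IsConformalMap.norm_apply {E F : Type*} [NormedAddCommGroup E] [InnerProductSpace ℝ E]
    [NormedAddCommGroup F] [InnerProductSpace ℝ F] {A : E →L[ℝ] F} (hA : IsConformalMap A) (v : E) :
    ‖A v‖ = ‖A‖ * ‖v‖ := by
  rcases subsingleton_or_nontrivial E with hE | hE
  · simp [Subsingleton.elim v 0]
  obtain ⟨c, hc, li, rfl⟩ := hA
  rw [norm_smul, li.norm_toContinuousLinearMap, mul_one]
  simp [norm_smul]

theorem IsConformalMap.norm_pos {E F : Type*} [NormedAddCommGroup E] [InnerProductSpace ℝ E]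
    [NormedAddCommGroup F] [InnerProductSpace ℝ F] [Nontrivial E] {A : E →L[ℝ] F}
    (hA : IsConformalMap A) : 0 < ‖A‖ := norm_pos_iff.2 hA.ne_zero

theorem IsConformalMap.norm_comp {E F : Type*} [NormedAddCommGroup E] [InnerProductSpace ℝ E]
    [NormedAddCommGroup F] [InnerProductSpace ℝ F] [Nontrivial E] {A : F →L[ℝ] F} {B : E →L[ℝ] F}
    (hA : IsConformalMap A) (hB : IsConformalMap B) : ‖A.comp B‖ = ‖A‖ * ‖B‖ := by
  obtain ⟨v, hv⟩ := exists_ne (0 : E)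
  have h := (hA.comp hB).norm_apply v
  rw [ContinuousLinearMap.comp_apply, hA.norm_apply, hB.norm_apply, ← mul_assoc] at h
  exact (mul_right_cancel₀ (norm_ne_zero_iff.2 hv) h).symm

theorem ConformalAt.isConformalMap_fderiv {E F : Type*} [NormedAddCommGroup E]
    [InnerProductSpace ℝ E] [NormedAddCommGroup F] [InnerProductSpace ℝ F] {f : E → F} {x : E}
    (h : ConformalAt f x) : IsConformalMap (fderiv ℝ f x) :=
  conformalAt_iff_isConformalMap_fderiv.1 h

theorem ConformalAt.norm_fderiv_comp {E : Type*} [NormedAddCommGroup E]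
    [InnerProductSpace ℝ E] [Nontrivial E] {f g : E → E} {x : E}
    (hg : ConformalAt g (f x)) (hf : ConformalAt f x) :
    ‖fderiv ℝ (g ∘ f) x‖ = ‖fderiv ℝ g (f x)‖ * ‖fderiv ℝ f x‖ := by
  rw [fderiv_comp x hg.differentiableAt hf.differentiableAt,
    hg.isConformalMap_fderiv.norm_comp hf.isConformalMap_fderiv]

variable {n : ℕ}

local notation "𝔼" => EuclideanSpace ℝ (Fin n)

theorem IsConformalMapping.comp {f g : 𝔼 → 𝔼} {G₁ G₂ G₃ : Set 𝔼}
    (hg : IsConformalMapping g G₂ G₃) (hf : IsConformalMapping f G₁ G₂) :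
    IsConformalMapping (g ∘ f) G₁ G₃ where
  contDiffOn := hg.contDiffOn.comp hf.contDiffOn hf.bijOn.mapsTo
  conformalAt x hx := (hg.conformalAt _ (hf.bijOn.mapsTo hx)).comp x (hf.conformalAt x hx)
  bijOn := hg.bijOn.comp hf.bijOn

/-- The inverse of a conformal mapping is a conformal mapping. -/
theorem IsConformalMapping.of_invOn {f g : 𝔼 → 𝔼} {G₁ G₂ : Set 𝔼} (hG : IsOpen G₁)
    (hf : IsConformalMapping f G₁ G₂) (hg : InvOn g f G₁ G₂) : IsConformalMapping g G₂ G₁ := by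
  have hgm : MapsTo g G₂ G₁ := fun y hy => by
    obtain ⟨x, hx, rfl⟩ := hf.bijOn.surjOn hy
    rwa [hg.1 hx]
  have key : ∀ y ∈ G₂, ContDiffAt ℝ 1 g y ∧ ConformalAt g y := by
    intro y hy
    obtain ⟨x, hx, rfl⟩ := hf.bijOn.surjOn hy
    obtain ⟨_, hA, c, hc, li, rfl⟩ := hf.conformalAt x hx
    let li' : 𝔼 ≃ₗᵢ[ℝ] 𝔼 := li.toLinearIsometryEquiv rfl
    have hli' : ∀ v, li' v = li v := fun v => rfl
    let e : 𝔼 ≃L[ℝ] 𝔼 := ContinuousLinearEquiv.equivOfInverse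
      (c • li.toContinuousLinearMap) (c⁻¹ • li'.symm.toLinearIsometry.toContinuousLinearMap)
      (fun v => by
        have : li'.symm (li v) = v := by rw [← hli', li'.symm_apply_apply]
        simp [this, smul_smul, hc])
      (fun v => by
        have : li (li'.symm v) = v := by rw [← hli', li'.apply_symm_apply]
        simp [this, smul_smul, hc])
    have hcd : ContDiffAt ℝ 1 f x := hf.contDiffOn.contDiffAt (hG.mem_nhds hx)
    have hA' : HasFDerivAt f (e : 𝔼 →L[ℝ] 𝔼) x := hA
    have hs := hcd.hasStrictFDerivAt' hA' one_ne_zero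
    -- Continuity of `g` is not assumed. The local inverse takes values in `G₁` near `f x`, and
    -- injectivity of `f` there identifies it with `g`.
    have hloc : g =ᶠ[𝓝 (f x)] hs.localInverse f e x := by
      have h1 : ∀ᶠ z in 𝓝 (f x), hs.localInverse f e x z ∈ G₁ := by
        refine hs.localInverse_continuousAt.eventually_mem ?_
        rw [hs.localInverse_apply_image]
        exact hG.mem_nhds hx
      filter_upwards [h1, hs.eventually_right_inverse] with z hz hz'
      rw [← hg.1 hz, hz']
    refine ⟨(hcd.to_localInverse hA' one_ne_zero).congr_of_eventuallyEq hloc,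
      _, (hs.to_localInverse.hasFDerivAt.congr_of_eventuallyEq hloc),
      c⁻¹, inv_ne_zero hc, li'.symm.toLinearIsometry, rfl⟩
  exact ⟨fun y hy => (key y hy).1.contDiffWithinAt, fun y hy => (key y hy).2,
    (hf.bijOn.symm hg.symm)⟩

theorem IsConformalMapping.invFunOn {f : 𝔼 → 𝔼} {G₁ G₂ : Set 𝔼} (hG : IsOpen G₁)
    (hf : IsConformalMapping f G₁ G₂) : IsConformalMapping (Function.invFunOn f G₁) G₂ G₁ :=
  hf.of_invOn hG hf.bijOn.invOn_invFunOn

theorem isOpen_unitBall : IsOpen (unitBall n) := isOpen_ball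

theorem zero_mem_unitBall : (0 : 𝔼) ∈ unitBall n := mem_ball_self one_pos

/-- Near `0` the ratio `‖F x‖ / ‖x‖` lies between `l - ε` and `l + ε`, so the capacity comparison
gives `log l ≤ n * log l` as `ε → 0`. This excludes `l < 1` because `n > 1`. -/
theorem one_le_norm_fderiv_zero (hn : 2 ≤ n) {F : 𝔼 → 𝔼}
    (hF : IsConformalMapping F (unitBall n) (unitBall n)) (hF0 : F 0 = 0) :
    1 ≤ ‖fderiv ℝ F 0‖ := by
  have : Nonempty (Fin n) := ⟨⟨0, by omega⟩⟩
  have hc := hF.conformalAt 0 zero_mem_unitBall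
  have hg := hF.invFunOn isOpen_unitBall
  have hinv := hF.bijOn.invOn_invFunOn
  set l := ‖fderiv ℝ F 0‖ with hl
  have hl0 : 0 < l := hc.isConformalMap_fderiv.norm_pos
  have hnorm := hc.isConformalMap_fderiv.norm_apply
  have key : ∀ ε ∈ Ioo 0 l, Real.log (l - ε) ≤ n * Real.log (l + ε) := by
    intro ε hε
    have hd := (hasFDerivAt_iff_isLittleO_nhds_zero.1 hc.differentiableAt.hasFDerivAt).def hε.1
    simp only [zero_add, hF0, sub_zero] at hd
    have := log_le_finrank_mul_log_of_conformal hF.contDiffOn hF.conformalAt hF.bijOn.mapsTo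
      hg.bijOn.mapsTo hg.contDiffOn.continuousOn hinv.1 hF0 (a := l - ε) (b := l + ε)
      (by linarith [hε.2]) (by linarith [hε.1]) ?_ ?_
    · simpa using this
    · filter_upwards [hd] with x hx
      have h1 := norm_sub_norm_le (fderiv ℝ F 0 x) (F x)
      rw [norm_sub_rev, hnorm, ← hl] at h1
      linarith
    · filter_upwards [hd] with x hx
      have h1 := norm_sub_norm_le (F x) (fderiv ℝ F 0 x)
      rw [hnorm, ← hl] at h1
      linarith
  have hlim1 : Tendsto (fun ε => Real.log (l - ε)) (𝓝[>] 0) (𝓝 (Real.log l)) := by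
    have : ContinuousAt (fun ε => Real.log (l - ε)) 0 := by
      fun_prop (disch := simp [hl0.ne'])
    simpa using this.tendsto.mono_left nhdsWithin_le_nhds
  have hlim2 : Tendsto (fun ε => n * Real.log (l + ε)) (𝓝[>] 0) (𝓝 (n * Real.log l)) := by
    have : ContinuousAt (fun ε => n * Real.log (l + ε)) 0 := by
      fun_prop (disch := simp [hl0.ne'])
    simpa using this.tendsto.mono_left nhdsWithin_le_nhds
  have h := le_of_tendsto_of_tendsto hlim1 hlim2 (by
    filter_upwards [Ioo_mem_nhdsGT hl0] with ε hε using key ε hε)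
  have hn' : (2 : ℝ) ≤ n := by exact_mod_cast hn
  by_contra! hlt
  have := Real.log_neg hl0 hlt
  nlinarith

theorem norm_fderiv_zero_le_one (hn : 2 ≤ n) {F : 𝔼 → 𝔼}
    (hF : IsConformalMapping F (unitBall n) (unitBall n)) (hF0 : F 0 = 0) :
    ‖fderiv ℝ F 0‖ ≤ 1 := by
  have : Nonempty (Fin n) := ⟨⟨0, by omega⟩⟩
  have hg := hF.invFunOn isOpen_unitBall
  have hinv := hF.bijOn.invOn_invFunOn
  have hg0 : Function.invFunOn F (unitBall n) 0 = 0 := by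
    simpa [hF0] using hinv.1 zero_mem_unitBall
  have h1 := one_le_norm_fderiv_zero hn hg hg0
  have h2 := ConformalAt.norm_fderiv_comp
    (hF0.symm ▸ hg.conformalAt 0 zero_mem_unitBall) (hF.conformalAt 0 zero_mem_unitBall)
  have h3 : Function.invFunOn F (unitBall n) ∘ F =ᶠ[𝓝 0] id := by
    filter_upwards [isOpen_unitBall.mem_nhds zero_mem_unitBall] with x hx using hinv.1 hx
  rw [h3.fderiv_eq, fderiv_id, ContinuousLinearMap.norm_id, hF0] at h2
  nlinarith [norm_nonneg (fderiv ℝ F 0)]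

end ConformalMaps

/-! ### Schwarz–Pick lemma in weighted models of hyperbolic space. -/

section HyperbolicModels

open MeasureTheory Set Filter Topology Metric
open scoped ENNReal

variable {n : ℕ}

local notation "𝔼" => EuclideanSpace ℝ (Fin n)

/-- For a weight `w` this is `sinh² (ρ / 2)`, where `ρ` is the hyperbolic metric with density
`2 / w`, when `w` is the natural weight of the ball or of the half-space. -/
noncomputable def hypRatio (w : 𝔼 → ℝ) (x y : 𝔼) : ℝ := dist x y ^ 2 / (w x * w y)

/-- The weight `1 - |x|²` of the unit ball. -/
noncomputable def ballWeight (x : 𝔼) : ℝ := 1 - ‖x‖ ^ 2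

/-- A conformal mapping that preserves the hyperbolic metrics given by two weights. -/
structure IsHypIsometry (φ : 𝔼 → 𝔼) (G₁ : Set 𝔼) (w₁ : 𝔼 → ℝ) (G₂ : Set 𝔼) (w₂ : 𝔼 → ℝ) : Prop
    extends IsConformalMapping φ G₁ G₂ where
  hypRatio_eq : ∀ x ∈ G₁, ∀ y ∈ G₁, hypRatio w₂ (φ x) (φ y) = hypRatio w₁ x y

/-- A domain with a weight that makes it a homogeneous model of hyperbolic space. -/
structure IsHypModel (G : Set 𝔼) (w : 𝔼 → ℝ) : Prop where
  isOpen : IsOpen G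
  pos : ∀ x ∈ G, 0 < w x
  continuousOn : ContinuousOn w G
  exists_isometry : ∀ p ∈ G, ∃ φ : 𝔼 → 𝔼, IsHypIsometry φ (unitBall n) ballWeight G w ∧ φ 0 = p

theorem IsHypIsometry.comp {φ ψ : 𝔼 → 𝔼} {G₁ G₂ G₃ : Set 𝔼} {w₁ w₂ w₃ : 𝔼 → ℝ}
    (hψ : IsHypIsometry ψ G₂ w₂ G₃ w₃) (hφ : IsHypIsometry φ G₁ w₁ G₂ w₂) :
    IsHypIsometry (ψ ∘ φ) G₁ w₁ G₃ w₃ where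
  toIsConformalMapping := hψ.toIsConformalMapping.comp hφ.toIsConformalMapping
  hypRatio_eq x hx y hy := (hψ.hypRatio_eq _ (hφ.bijOn.mapsTo hx) _ (hφ.bijOn.mapsTo hy)).trans
    (hφ.hypRatio_eq x hx y hy)

theorem ballWeight_pos {x : 𝔼} (hx : x ∈ unitBall n) : 0 < ballWeight x := by
  have : ‖x‖ < 1 := mem_ball_zero_iff.1 hx
  have := norm_nonneg x
  unfold ballWeight
  nlinarith

theorem continuous_ballWeight : Continuous (ballWeight : 𝔼 → ℝ) := by
  unfold ballWeight
  fun_prop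

/-- The infinitesimal form of the preservation of the hyperbolic metric. -/
theorem IsHypIsometry.norm_fderiv_mul [Nontrivial 𝔼] {φ : 𝔼 → 𝔼} {G₁ G₂ : Set 𝔼} {w₁ w₂ : 𝔼 → ℝ}
    (hφ : IsHypIsometry φ G₁ w₁ G₂ w₂) (h₁ : IsOpen G₁) (h₂ : IsOpen G₂)
    (hw₁ : ContinuousOn w₁ G₁) (hw₂ : ContinuousOn w₂ G₂) (hp₁ : ∀ x ∈ G₁, 0 < w₁ x)
    (hp₂ : ∀ x ∈ G₂, 0 < w₂ x) {x : 𝔼} (hx : x ∈ G₁) :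
    ‖fderiv ℝ φ x‖ * w₁ x = w₂ (φ x) := by
  have hc := hφ.conformalAt x hx
  have hy := hφ.bijOn.mapsTo hx
  -- The identity of the two ratios for `x + t v` and `x` is divided by `t ^ 2`, and `t → 0`. One
  -- direction suffices, since the derivative scales all directions alike.
  obtain ⟨v, hv⟩ := exists_norm_eq 𝔼 zero_le_one
  set c : ℝ → 𝔼 := fun t => x + t • v with hcdef
  have hc0 : c 0 = x := by simp [hcdef]
  have hcc : Continuous c := by fun_prop
  have hcd : HasDerivAt c v 0 := by
    simpa [hcdef] using ((hasDerivAt_id (0 : ℝ)).smul_const v).const_add x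
  have hd : HasDerivAt (φ ∘ c) (fderiv ℝ φ x v) 0 := by
    have h := hc.differentiableAt.hasFDerivAt
    rw [← hc0] at h
    simpa [hc0] using h.comp_hasDerivAt 0 hcd
  have hlim1 : Tendsto (fun t => ‖slope (φ ∘ c) 0 t‖ ^ 2) (𝓝[≠] 0) (𝓝 (‖fderiv ℝ φ x‖ ^ 2)) := by
    have := (hd.tendsto_slope.norm).pow 2
    rwa [hc.isConformalMap_fderiv.norm_apply, hv, mul_one] at this
  have hcx : Tendsto c (𝓝[≠] 0) (𝓝 x) := by
    have := hcc.tendsto 0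
    rw [hc0] at this
    exact this.mono_left nhdsWithin_le_nhds
  have hlim2 : Tendsto (fun t => w₂ (φ (c t)) * w₂ (φ x) / (w₁ (c t) * w₁ x)) (𝓝[≠] 0)
      (𝓝 (w₂ (φ x) * w₂ (φ x) / (w₁ x * w₁ x))) := by
    have a1 := (hw₁.continuousAt (h₁.mem_nhds hx)).tendsto.comp hcx
    have a2 := ((hw₂.continuousAt (h₂.mem_nhds hy)).tendsto.comp
      hc.differentiableAt.continuousAt.tendsto).comp hcx
    exact (a2.mul_const _).div (a1.mul_const _) (mul_pos (hp₁ x hx) (hp₁ x hx)).ne'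
  have heq : (fun t => ‖slope (φ ∘ c) 0 t‖ ^ 2) =ᶠ[𝓝[≠] 0]
      fun t => w₂ (φ (c t)) * w₂ (φ x) / (w₁ (c t) * w₁ x) := by
    filter_upwards [hcx.eventually_mem (h₁.mem_nhds hx), self_mem_nhdsWithin] with t ht ht0
    have ht0 : t ≠ 0 := ht0
    have h := hφ.hypRatio_eq _ ht _ hx
    have p1 := hp₁ _ ht
    have p2 := hp₁ _ hx
    have p3 := hp₂ _ (hφ.bijOn.mapsTo ht)
    have p4 := hp₂ _ hy
    have hdist : dist (c t) x ^ 2 = t ^ 2 := by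
      simp [hcdef, dist_eq_norm, norm_smul, hv]
    rw [hypRatio, hypRatio, hdist] at h
    have hs : ‖slope (φ ∘ c) 0 t‖ ^ 2 = dist (φ (c t)) (φ x) ^ 2 / t ^ 2 := by
      rw [slope_def_module, Function.comp_apply, Function.comp_apply, hc0, norm_smul, dist_eq_norm,
        mul_pow, norm_inv, Real.norm_eq_abs, inv_pow, sq_abs, sub_zero]
      field_simp
    rw [hs]
    field_simp at h ⊢
    linarith
  have h := tendsto_nhds_unique (hlim1.congr' heq) hlim2
  have p2 := hp₁ _ hx
  have p4 := hp₂ _ hy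
  have h' : (‖fderiv ℝ φ x‖ * w₁ x) ^ 2 = w₂ (φ x) ^ 2 := by
    rw [mul_pow, h]; field_simp
  exact (pow_left_inj₀ (by positivity) p4.le two_ne_zero).1 h'

/-- Homogeneity reduces statements at an arbitrary point to a self-map of the ball fixing the
origin. -/
theorem IsHypModel.exists_conjugate {G₁ G₂ : Set 𝔼} {w₁ w₂ : 𝔼 → ℝ}
    (h₁ : IsHypModel G₁ w₁) (h₂ : IsHypModel G₂ w₂) {f : 𝔼 → 𝔼} (hf : IsConformalMapping f G₁ G₂)
    {p : 𝔼} (hp : p ∈ G₁) :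
    ∃ φ ψ h : 𝔼 → 𝔼, IsHypIsometry φ (unitBall n) ballWeight G₁ w₁ ∧ φ 0 = p ∧
      IsHypIsometry ψ (unitBall n) ballWeight G₂ w₂ ∧ ψ 0 = f p ∧
      IsConformalMapping h (unitBall n) (unitBall n) ∧ h 0 = 0 ∧
      EqOn (ψ ∘ h) (f ∘ φ) (unitBall n) := by
  obtain ⟨φ, hφ, hφ0⟩ := h₁.exists_isometry p hp
  obtain ⟨ψ, hψ, hψ0⟩ := h₂.exists_isometry (f p) (hf.bijOn.mapsTo hp)
  have hinv := hψ.bijOn.invOn_invFunOn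
  refine ⟨φ, ψ, Function.invFunOn ψ (unitBall n) ∘ f ∘ φ, hφ, hφ0, hψ, hψ0,
    (hψ.toIsConformalMapping.invFunOn isOpen_unitBall).comp (hf.comp hφ.toIsConformalMapping),
    ?_, fun x hx => hinv.2 (hf.bijOn.mapsTo (hφ.bijOn.mapsTo hx))⟩
  rw [Function.comp_apply, Function.comp_apply, hφ0, ← hψ0]
  exact hinv.1 zero_mem_unitBall

/-- Infinitesimal Schwarz–Pick lemma for conformal mappings. -/
theorem IsHypModel.norm_fderiv_mul_le (hn : 2 ≤ n) {G₁ G₂ : Set 𝔼} {w₁ w₂ : 𝔼 → ℝ}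
    (h₁ : IsHypModel G₁ w₁) (h₂ : IsHypModel G₂ w₂) {f : 𝔼 → 𝔼} (hf : IsConformalMapping f G₁ G₂)
    {p : 𝔼} (hp : p ∈ G₁) : ‖fderiv ℝ f p‖ * w₁ p ≤ w₂ (f p) := by
  have : Nonempty (Fin n) := ⟨⟨0, by omega⟩⟩
  obtain ⟨φ, ψ, h, hφ, rfl, hψ, hψ0, hh, hh0, heq⟩ := h₁.exists_conjugate h₂ hf hp
  have z := zero_mem_unitBall (n := n)
  have e1 := hφ.norm_fderiv_mul isOpen_unitBall h₁.isOpen continuous_ballWeight.continuousOn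
    h₁.continuousOn (fun x hx => ballWeight_pos hx) h₁.pos z
  have e2 := hψ.norm_fderiv_mul isOpen_unitBall h₂.isOpen continuous_ballWeight.continuousOn
    h₂.continuousOn (fun x hx => ballWeight_pos hx) h₂.pos z
  have e3 := ConformalAt.norm_fderiv_comp (hf.conformalAt _ hp) (hφ.conformalAt 0 z)
  have e4 := ConformalAt.norm_fderiv_comp (hh0.symm ▸ hψ.conformalAt 0 z) (hh.conformalAt 0 z)
  have e5 : ψ ∘ h =ᶠ[𝓝 0] f ∘ φ := heq.eventuallyEq_of_mem (isOpen_unitBall.mem_nhds z)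
  have e6 := norm_fderiv_zero_le_one hn hh hh0
  have hw0 : ballWeight (0 : 𝔼) = 1 := by simp [ballWeight]
  rw [hw0, mul_one] at e1 e2
  rw [e5.fderiv_eq, e3, hh0, e1, e2, hψ0] at e4
  rw [e4]
  exact mul_le_of_le_one_right (h₂.pos _ (hf.bijOn.mapsTo hp)).le e6

/-- The hyperbolic distance from `0` to a point of norm `u` is `log ((1 + u) / (1 - u))`. Along a
radius the derivative bound makes this distance grow no faster for the image than for the point. -/
theorem norm_le_of_norm_fderiv_mul_le {F : 𝔼 → 𝔼}
    (hF : IsConformalMapping F (unitBall n) (unitBall n)) (hF0 : F 0 = 0)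
    (hd : ∀ x ∈ unitBall n, ‖fderiv ℝ F x‖ * ballWeight x ≤ ballWeight (F x)) {x : 𝔼}
    (hx : x ∈ unitBall n) : ‖F x‖ ≤ ‖x‖ := by
  rcases eq_or_ne x 0 with rfl | hx0
  · simp [hF0]
  set T := ‖x‖ with hT
  have hT0 : 0 < T := norm_pos_iff.2 hx0
  have hT1 : T < 1 := mem_ball_zero_iff.1 hx
  set θ : 𝔼 := T⁻¹ • x with hθdef
  have hθ : ‖θ‖ = 1 := by 
    rw [hθdef, norm_smul, norm_inv, Real.norm_of_nonneg hT0.le, ← hT, inv_mul_cancel₀ hT0.ne']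
  have hxθ : T • θ = x := by rw [hθdef, smul_smul, mul_inv_cancel₀ hT0.ne', one_smul]
  have hn : ∀ t ∈ Icc 0 T, ‖t • θ‖ = t := fun t ht => by
    rw [norm_smul, hθ, mul_one, Real.norm_of_nonneg ht.1]
  have hmem : ∀ t ∈ Icc 0 T, t • θ ∈ unitBall n := fun t ht => by
    rw [unitBall, mem_ball_zero_iff, hn t ht]; exact ht.2.trans_lt hT1
  have hu1 : ∀ t ∈ Icc 0 T, ‖F (t • θ)‖ < 1 := fun t ht =>
    mem_ball_zero_iff.1 (hF.bijOn.mapsTo (hmem t ht))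
  -- `D` is the hyperbolic distance of the image from `0` minus that of the point; it vanishes at `t
  -- = 0` and is antitone.
  set D : ℝ → ℝ := fun t => (Real.log (1 + ‖F (t • θ)‖) - Real.log (1 - ‖F (t • θ)‖)) -
    (Real.log (1 + t) - Real.log (1 - t)) with hD
  have hcont : ContinuousOn D (Icc 0 T) := by
    have hc : ContinuousOn (fun t : ℝ => ‖F (t • θ)‖) (Icc 0 T) :=
      (hF.contDiffOn.continuousOn.comp (by fun_prop) hmem).norm
    refine (((continuousOn_const.add hc).log fun t ht => ?_).sub
      ((continuousOn_const.sub hc).log fun t ht => ?_)).sub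
      (((continuousOn_const.add continuousOn_id).log fun t ht => ?_).sub
      ((continuousOn_const.sub continuousOn_id).log fun t ht => ?_))
    · exact (add_pos_of_pos_of_nonneg one_pos (norm_nonneg (F (t • θ)))).ne'
    · exact (sub_pos.2 (hu1 t ht)).ne'
    · exact (add_pos_of_pos_of_nonneg one_pos ht.1).ne'
    · exact (sub_pos.2 (ht.2.trans_lt hT1)).ne'
  have hanti : AntitoneOn D (Icc 0 T) := by
    refine antitoneOn_of_hasDerivWithinAt_nonpos (convex_Icc 0 T) hcont
      (f' := fun t => 2 * (inner ℝ (F (t • θ)) (fderiv ℝ F (t • θ) θ) / ‖F (t • θ)‖) /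
        ballWeight (F (t • θ)) - 2 / (1 - t ^ 2)) ?_ ?_
    · intro t ht
      rw [interior_Icc] at ht
      have ht' := Ioo_subset_Icc_self ht
      have hdiff := (hF.conformalAt _ (hmem t ht')).differentiableAt
      have hne : F (t • θ) ≠ 0 := fun h0 => by
        have := hF.bijOn.injOn (hmem t ht') zero_mem_unitBall (h0.trans hF0.symm)
        rw [← norm_eq_zero, hn t ht'] at this
        exact ht.1.ne' this
      have hu := hu1 t ht'
      have hu0 : 0 < ‖F (t • θ)‖ := norm_pos_iff.2 hne
      have h1 : HasDerivAt (fun s : ℝ => ‖F (s • θ)‖)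
          (inner ℝ (F (t • θ)) (fderiv ℝ F (t • θ) θ) / ‖F (t • θ)‖) t := by
        have h := ((hasDerivAt_comp_smul hdiff).norm_sq).sqrt (by positivity)
        simp only [Real.sqrt_sq (norm_nonneg _)] at h
        refine h.congr_deriv ?_
        field_simp
      have ht1 : t < 1 := ht.2.trans hT1
      have ht0 : 0 < t := ht.1
      have h2 := (((h1.const_add 1).log (by positivity)).sub
        ((h1.const_sub 1).log (sub_pos.2 hu).ne')).sub
        ((((hasDerivAt_id t).const_add 1).log (by simp only [id]; positivity)).sub
        (((hasDerivAt_id t).const_sub 1).log (sub_pos.2 ht1).ne'))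
      refine (h2.congr_deriv ?_).hasDerivWithinAt
      have a1 : 1 - ‖F (t • θ)‖ ≠ 0 := (sub_pos.2 hu).ne'
      have a2 : 1 - t ≠ 0 := (sub_pos.2 ht1).ne'
      have a3 : 1 + ‖F (t • θ)‖ ≠ 0 := by positivity
      have a4 : 1 + t ≠ 0 := by positivity
      have a5 : 1 - ‖F (t • θ)‖ ^ 2 = (1 - ‖F (t • θ)‖) * (1 + ‖F (t • θ)‖) := by ring
      have a6 : 1 - t ^ 2 = (1 - t) * (1 + t) := by ring
      simp only [ballWeight, a5, a6, id]
      field_simp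
      ring
    · intro t ht
      rw [interior_Icc] at ht
      have ht' := Ioo_subset_Icc_self ht
      have h1 := hd _ (hmem t ht')
      have hw : ballWeight (t • θ) = 1 - t ^ 2 := by rw [ballWeight, hn t ht']
      have hwt : 0 < 1 - t ^ 2 := hw ▸ ballWeight_pos (hmem t ht')
      have hwF := ballWeight_pos (hF.bijOn.mapsTo (hmem t ht'))
      have h2 : inner ℝ (F (t • θ)) (fderiv ℝ F (t • θ) θ) / ‖F (t • θ)‖ ≤
          ‖fderiv ℝ F (t • θ)‖ := by
        have h3 := (fderiv ℝ F (t • θ)).le_opNorm θ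
        rw [hθ, mul_one] at h3
        refine (div_le_of_le_mul₀ (norm_nonneg _) (norm_nonneg _) ?_).trans h3
        rw [mul_comm]
        exact real_inner_le_norm _ _
      rw [hw] at h1
      have h4 : ‖fderiv ℝ F (t • θ)‖ / ballWeight (F (t • θ)) ≤ 1 / (1 - t ^ 2) := by
        rw [div_le_div_iff₀ hwF hwt]; linarith
      have h5 : inner ℝ (F (t • θ)) (fderiv ℝ F (t • θ) θ) / ‖F (t • θ)‖ /
          ballWeight (F (t • θ)) ≤ 1 / (1 - t ^ 2) :=
        (div_le_div_of_nonneg_right h2 hwF.le).trans h4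
      have h6 : (2 : ℝ) / (1 - t ^ 2) = 2 * (1 / (1 - t ^ 2)) := by ring
      rw [mul_div_assoc, h6]
      linarith
  have h := hanti (left_mem_Icc.2 hT0.le) (right_mem_Icc.2 hT0.le) hT0.le
  simp only [hD, hxθ, zero_smul, hF0, norm_zero, add_zero, sub_zero, Real.log_one] at h
  by_contra! hlt
  have hFx : ‖F x‖ < 1 := mem_ball_zero_iff.1 (hF.bijOn.mapsTo hx)
  have l1 : Real.log (1 + T) < Real.log (1 + ‖F x‖) :=
    Real.log_lt_log (by positivity) (by linarith)
  have l2 : Real.log (1 - ‖F x‖) < Real.log (1 - T) :=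
    Real.log_lt_log (by linarith) (by linarith)
  linarith

theorem hypRatio_ballWeight_zero_le {x y : 𝔼} (hy : y ∈ unitBall n) (h : ‖x‖ ≤ ‖y‖) :
    hypRatio ballWeight 0 x ≤ hypRatio ballWeight 0 y := by
  have hy1 := ballWeight_pos hy
  have hxy : ‖x‖ ^ 2 ≤ ‖y‖ ^ 2 := by gcongr
  have hle : ballWeight y ≤ ballWeight x := by unfold ballWeight; linarith
  have hw0 : ballWeight (0 : 𝔼) = 1 := by simp [ballWeight]
  rw [hypRatio, hypRatio, hw0, one_mul, one_mul, dist_zero_left, dist_zero_left]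
  gcongr

/-- Schwarz–Pick lemma for conformal mappings. -/
theorem IsHypModel.hypRatio_le (hn : 2 ≤ n) (hB : IsHypModel (unitBall n) ballWeight)
    {G₁ G₂ : Set 𝔼} {w₁ w₂ : 𝔼 → ℝ}
    (h₁ : IsHypModel G₁ w₁) (h₂ : IsHypModel G₂ w₂) {f : 𝔼 → 𝔼} (hf : IsConformalMapping f G₁ G₂)
    {x y : 𝔼} (hx : x ∈ G₁) (hy : y ∈ G₁) :
    hypRatio w₂ (f x) (f y) ≤ hypRatio w₁ x y := by
  obtain ⟨φ, ψ, h, hφ, rfl, hψ, hψ0, hh, hh0, heq⟩ := h₁.exists_conjugate h₂ hf hx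
  obtain ⟨z, hz, rfl⟩ := hφ.bijOn.surjOn hy
  have z0 := zero_mem_unitBall (n := n)
  have e := heq hz
  simp only [Function.comp_apply] at e
  rw [← hψ0, ← e, hψ.hypRatio_eq _ z0 _ (hh.bijOn.mapsTo hz), hφ.hypRatio_eq _ z0 _ hz]
  exact hypRatio_ballWeight_zero_le hz (norm_le_of_norm_fderiv_mul_le hh hh0
    (fun x hx => hB.norm_fderiv_mul_le hn hB hh hx) hz)

end HyperbolicModels
-- The half-space and ball models, and comparison of `t` with `tanh (ρ / 2)`.
section Models

open MeasureTheory Set Filter Topology Metric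
open scoped ENNReal

variable {n : ℕ}

local notation "𝔼" => EuclideanSpace ℝ (Fin n)

theorem IsHypIsometry.of_invOn {φ ψ : 𝔼 → 𝔼} {G₁ G₂ : Set 𝔼} {w₁ w₂ : 𝔼 → ℝ} (hG : IsOpen G₁)
    (hφ : IsHypIsometry φ G₁ w₁ G₂ w₂) (hinv : InvOn ψ φ G₁ G₂) : IsHypIsometry ψ G₂ w₂ G₁ w₁ where
  toIsConformalMapping := hφ.toIsConformalMapping.of_invOn hG hinv
  hypRatio_eq x hx y hy := by
    have h := (hφ.toIsConformalMapping.of_invOn hG hinv).bijOn.mapsTo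
    have := hφ.hypRatio_eq _ (h hx) _ (h hy)
    rw [hinv.2 hx, hinv.2 hy] at this
    exact this.symm

/-- The weight `2 xᵢ` of the half-space `xᵢ > 0`. -/
noncomputable def halfWeight (i : Fin n) (x : 𝔼) : ℝ := 2 * x i

theorem upperHalfSpace_eq {i : Fin n} (hi : (i : ℕ) + 1 = n) :
    upperHalfSpace n = {x : 𝔼 | 0 < x i} := by
  ext x
  refine ⟨fun h => h i hi, fun h j hj => ?_⟩
  obtain rfl : j = i := Fin.ext (by omega)
  exact h

/-- The inversion that interchanges the unit ball and the half-space `xᵢ > 0`. -/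
noncomputable def cayleyInversion (i : Fin n) : 𝔼 → 𝔼 :=
  EuclideanGeometry.inversion (-EuclideanSpace.single i (1 : ℝ)) (√2)

theorem cayleyInversion_cayleyInversion (i : Fin n) (x : 𝔼) :
    cayleyInversion i (cayleyInversion i x) = x :=
  EuclideanGeometry.inversion_inversion _ (by positivity) x

theorem norm_add_single_sq (i : Fin n) (x : 𝔼) :
    ‖x + EuclideanSpace.single i (1 : ℝ)‖ ^ 2 = ‖x‖ ^ 2 + 2 * x i + 1 := by
  rw [norm_add_sq_real, EuclideanSpace.inner_single_right]
  simp

theorem cayleyInversion_apply (i : Fin n) {x : 𝔼} :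
    cayleyInversion i x = (2 / ‖x + EuclideanSpace.single i (1 : ℝ)‖ ^ 2) •
      (x + EuclideanSpace.single i (1 : ℝ)) - EuclideanSpace.single i (1 : ℝ) := by
  rw [cayleyInversion, EuclideanGeometry.inversion, dist_eq_norm, div_pow,
    Real.sq_sqrt zero_le_two]
  simp [sub_eq_add_neg]

theorem ne_neg_single_of_mem_unitBall (i : Fin n) {x : 𝔼} (hx : x ∈ unitBall n) :
    x ≠ -EuclideanSpace.single i (1 : ℝ) := by
  rintro rfl
  simp [unitBall] at hx

/-- The factor in front of `ballWeight x` is the conformal factor of the inversion at `x`. Such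
factors cancel against the distortion of distances in `hypRatio`. -/
theorem halfWeight_cayleyInversion (i : Fin n) {x : 𝔼} (hx : x ≠ -EuclideanSpace.single i (1 : ℝ)) :
    halfWeight i (cayleyInversion i x) =
      2 / ‖x + EuclideanSpace.single i (1 : ℝ)‖ ^ 2 * ballWeight x := by
  have h : 0 < ‖x + EuclideanSpace.single i (1 : ℝ)‖ ^ 2 := by
    have : x + EuclideanSpace.single i (1 : ℝ) ≠ 0 := fun h => hx (eq_neg_of_add_eq_zero_left h)
    positivity
  rw [cayleyInversion_apply, halfWeight, ballWeight]
  simp only [PiLp.sub_apply, PiLp.smul_apply, PiLp.add_apply, PiLp.single_apply, if_true,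
    smul_eq_mul]
  have h' := norm_add_single_sq i x
  set N := ‖x + EuclideanSpace.single i (1 : ℝ)‖ ^ 2
  field_simp
  linarith

theorem isHypIsometry_cayleyInversion {i : Fin n} (hi : (i : ℕ) + 1 = n) :
    IsHypIsometry (cayleyInversion i) (unitBall n) ballWeight (upperHalfSpace n)
      (halfWeight i) where
  contDiffOn := contDiffOn_const.inversion contDiffOn_const contDiffOn_id
    fun x hx => ne_neg_single_of_mem_unitBall i hx
  conformalAt x hx := by
    have hne := ne_neg_single_of_mem_unitBall i hx
    refine ⟨_, EuclideanGeometry.hasFDerivAt_inversion hne, _,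
      pow_ne_zero 2 (div_ne_zero (by positivity) (dist_ne_zero.2 hne)),
      ((Submodule.span ℝ {x - -EuclideanSpace.single i (1 : ℝ)})ᗮ.reflection).toLinearIsometry, rfl⟩
  bijOn := by
    refine InvOn.bijOn (f' := cayleyInversion i)
      ⟨fun x _ => cayleyInversion_cayleyInversion i x,
        fun x _ => cayleyInversion_cayleyInversion i x⟩ (fun x hx => ?_) (fun x hx => ?_)
    · rw [upperHalfSpace_eq hi]
      have hne := ne_neg_single_of_mem_unitBall i hx
      have h := halfWeight_cayleyInversion i hne
      have hb := ballWeight_pos hx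
      have : x + EuclideanSpace.single i (1 : ℝ) ≠ 0 := fun h => hne (eq_neg_of_add_eq_zero_left h)
      have hpos : 0 < 2 / ‖x + EuclideanSpace.single i (1 : ℝ)‖ ^ 2 * ballWeight x := by positivity
      rw [← h, halfWeight] at hpos
      show 0 < cayleyInversion i x i
      linarith
    · rw [upperHalfSpace_eq hi] at hx
      have hx : 0 < x i := hx
      -- By convention the inversion fixes its centre, and the centre is not in the half-space.
      have hne : cayleyInversion i x ≠ -EuclideanSpace.single i (1 : ℝ) := by
        intro h
        have h1 := (EuclideanGeometry.inversion_eq_center (by positivity : √2 ≠ 0)).1 h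
        rw [h1] at hx
        simp at hx
        linarith
      have h := halfWeight_cayleyInversion i hne
      rw [cayleyInversion_cayleyInversion, halfWeight] at h
      have hb : 0 < ballWeight (cayleyInversion i x) := by
        by_contra! hle
        have : 2 / ‖cayleyInversion i x + EuclideanSpace.single i (1 : ℝ)‖ ^ 2 *
            ballWeight (cayleyInversion i x) ≤ 0 :=
          mul_nonpos_of_nonneg_of_nonpos (by positivity) hle
        linarith
      rw [unitBall, mem_ball_zero_iff]
      unfold ballWeight at hb
      nlinarith [norm_nonneg (cayleyInversion i x)]
  hypRatio_eq x hx y hy := by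
    have hx' := ne_neg_single_of_mem_unitBall i hx
    have hy' := ne_neg_single_of_mem_unitBall i hy
    have hx0 : x + EuclideanSpace.single i (1 : ℝ) ≠ 0 :=
      fun h => hx' (eq_neg_of_add_eq_zero_left h)
    have hy0 : y + EuclideanSpace.single i (1 : ℝ) ≠ 0 :=
      fun h => hy' (eq_neg_of_add_eq_zero_left h)
    have hbx := ballWeight_pos hx
    have hby := ballWeight_pos hy
    rw [hypRatio, hypRatio, halfWeight_cayleyInversion i hx', halfWeight_cayleyInversion i hy',
      cayleyInversion, EuclideanGeometry.dist_inversion_inversion hx' hy',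
      Real.sq_sqrt zero_le_two, dist_eq_norm x (-_), dist_eq_norm y (-_), sub_neg_eq_add,
      sub_neg_eq_add]
    field_simp

theorem isHypIsometry_affine {i : Fin n} (hi : (i : ℕ) + 1 = n) {c : ℝ} (hc : 0 < c) {b : 𝔼}
    (hb : b i = 0) :
    IsHypIsometry (fun x => c • x + b) (upperHalfSpace n) (halfWeight i) (upperHalfSpace n)
      (halfWeight i) where
  contDiffOn := by fun_prop
  conformalAt x _ := by
    obtain ⟨A, hA, hA'⟩ := conformalAt_const_smul (X := 𝔼) hc.ne' x
    exact ⟨A, hA.add_const b, hA'⟩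
  bijOn := by
    rw [upperHalfSpace_eq hi]
    refine InvOn.bijOn (f' := fun x => c⁻¹ • (x - b))
      ⟨fun x _ => by simp [smul_smul, hc.ne'], fun x _ => by simp [smul_smul, hc.ne']⟩
      (fun x hx => ?_) (fun x hx => ?_)
    · have hx : 0 < x i := hx
      show 0 < (c • x + b) i
      simp only [PiLp.add_apply, PiLp.smul_apply, smul_eq_mul, hb]
      positivity
    · have hx : 0 < x i := hx
      show 0 < (c⁻¹ • (x - b)) i
      simp only [PiLp.sub_apply, PiLp.smul_apply, smul_eq_mul, hb, sub_zero]
      positivity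
  hypRatio_eq x hx y hy := by
    rw [upperHalfSpace_eq hi] at hx hy
    have hx : 0 < x i := hx
    have hy : 0 < y i := hy
    simp only [hypRatio, halfWeight, dist_add_right, dist_smul₀, Real.norm_of_nonneg hc.le,
      PiLp.add_apply, PiLp.smul_apply, smul_eq_mul, hb, add_zero]
    field_simp

theorem isOpen_upperHalfSpace {i : Fin n} (hi : (i : ℕ) + 1 = n) : IsOpen (upperHalfSpace n) := by
  rw [upperHalfSpace_eq hi]
  exact isOpen_lt continuous_const (by fun_prop)

theorem isHypModel_upperHalfSpace {i : Fin n} (hi : (i : ℕ) + 1 = n) :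
    IsHypModel (upperHalfSpace n) (halfWeight i) where
  isOpen := isOpen_upperHalfSpace hi
  pos x hx := mul_pos two_pos (hx i hi)
  continuousOn := by unfold halfWeight; fun_prop
  exists_isometry p hp := by
    have hpi : 0 < p i := hp i hi
    -- The inversion sends `0` to the unit vector `e`; scaling by `p i` and the horizontal shift by
    -- `p - p i • e` then reach `p`.
    refine ⟨_, (isHypIsometry_affine hi hpi (b := p - p i • EuclideanSpace.single i (1 : ℝ))
      (by simp)).comp (isHypIsometry_cayleyInversion hi), ?_⟩
    have : cayleyInversion i 0 = EuclideanSpace.single i (1 : ℝ) := by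
      rw [cayleyInversion_apply]
      simp [two_smul]
    simp [this]

theorem isHypModel_unitBall {i : Fin n} (hi : (i : ℕ) + 1 = n) :
    IsHypModel (unitBall n) ballWeight where
  isOpen := isOpen_unitBall
  pos x hx := ballWeight_pos hx
  continuousOn := continuous_ballWeight.continuousOn
  exists_isometry p hp := by
    have hC := isHypIsometry_cayleyInversion hi
    obtain ⟨φ, hφ, hφ0⟩ := (isHypModel_upperHalfSpace hi).exists_isometry _ (hC.bijOn.mapsTo hp)
    refine ⟨_, (hC.of_invOn isOpen_unitBall (ψ := cayleyInversion i)
      ⟨fun x _ => cayleyInversion_cayleyInversion i x,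
        fun x _ => cayleyInversion_cayleyInversion i x⟩).comp hφ, ?_⟩
    rw [Function.comp_apply, hφ0, cayleyInversion_cayleyInversion]

theorem infDist_frontier_unitBall [Nontrivial 𝔼] {x : 𝔼} (hx : x ∈ unitBall n) :
    infDist x (frontier (unitBall n)) = 1 - ‖x‖ := by
  have hx1 : ‖x‖ < 1 := mem_ball_zero_iff.1 hx
  rw [unitBall, frontier_ball _ one_ne_zero]
  obtain ⟨u, hu, hux⟩ : ∃ u : 𝔼, ‖u‖ = 1 ∧ x = ‖x‖ • u := by
    rcases eq_or_ne x 0 with rfl | h0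
    · obtain ⟨u, hu⟩ := exists_norm_eq 𝔼 zero_le_one
      exact ⟨u, hu, by simp⟩
    · exact ⟨‖x‖⁻¹ • x, norm_smul_inv_norm (𝕜 := ℝ) h0, by
        rw [smul_smul, mul_inv_cancel₀ (norm_ne_zero_iff.2 h0), one_smul]⟩
  have hus : u ∈ sphere (0 : 𝔼) 1 := by simpa using hu
  refine le_antisymm ((infDist_le_dist_of_mem hus).trans_eq ?_) ?_
  · have : x - u = (‖x‖ - 1) • u := by rw [sub_smul, one_smul, ← hux]
    rw [dist_eq_norm, this, norm_smul, hu, mul_one, Real.norm_eq_abs, abs_of_neg (by linarith)]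
    ring
  · refine (le_infDist ⟨u, hus⟩).2 fun z hz => ?_
    have h1 := norm_sub_norm_le z x
    rw [mem_sphere_zero_iff_norm.1 hz, ← dist_eq_norm, dist_comm] at h1
    exact h1

theorem infDist_frontier_upperHalfSpace {i : Fin n} (hi : (i : ℕ) + 1 = n) {x : 𝔼}
    (hx : x ∈ upperHalfSpace n) : infDist x (frontier (upperHalfSpace n)) = x i := by
  have hxi : 0 < x i := hx i hi
  have hfr : frontier (upperHalfSpace n) = {z : 𝔼 | z i = 0} := by
    have hopen : IsOpenMap fun z : 𝔼 => z i :=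
      ContinuousLinearMap.isOpenMap (EuclideanSpace.proj i : 𝔼 →L[ℝ] ℝ)
        fun t => ⟨EuclideanSpace.single i t, by simp⟩
    have h := hopen.preimage_frontier_eq_frontier_preimage (by fun_prop) (Ioi 0)
    rw [frontier_Ioi] at h
    rw [upperHalfSpace_eq hi]
    exact h.symm
  rw [hfr]
  have hz : x - x i • EuclideanSpace.single i (1 : ℝ) ∈ {z : 𝔼 | z i = 0} := by simp
  refine le_antisymm ((infDist_le_dist_of_mem hz).trans_eq ?_) ((le_infDist ⟨_, hz⟩).2 ?_)
  · simp [norm_smul, abs_of_pos hxi]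
  · intro y hy
    have hy : y i = 0 := hy
    have := PiLp.norm_apply_le (x - y) i
    rw [PiLp.sub_apply, hy, sub_zero, Real.norm_of_nonneg hxi.le] at this
    rwa [dist_eq_norm]

/-- Here `p`, `q` are the boundary distances and `s` is the distance of the points. Left minus right
is a concave quadratic in `s` with vertex `(p + q) / 3`. The three cases place the vertex left of,
inside or right of `[p - q, 2 - p - q]`, and the worst `s` is `p - q`, the vertex or `2 - p - q`
respectively. -/
theorem add_sq_le_four_mul_of_ball {p q s : ℝ} (hq : 0 < q) (hqp : q ≤ p) (hp : p ≤ 1)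
    (h1 : p - q ≤ s) (h2 : s ≤ 2 - p - q) :
    (s + p + q) ^ 2 ≤ 4 * (s ^ 2 + p * (2 - p) * (q * (2 - q))) := by
  rcases le_or_gt (2 * q) p with h | h
  · have e1 : 0 ≤ (s - (p - q)) * (3 * (s + (p - q)) - 2 * (p + q)) :=
      mul_nonneg (by linarith) (by linarith)
    have e2 : 0 ≤ 4 * q * (q * (1 - p) ^ 2 + 2 * (p * (1 - p))) := by
      have : 0 ≤ p * (1 - p) := mul_nonneg (by linarith) (by linarith)
      positivity
    linear_combination e1 + e2
  rcases le_or_gt (p + q) (3 / 2) with hc | hc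
  · have e1 : 2 * (p + q) ^ 2 ≤ 9 * (p * q) := by
      nlinarith [mul_nonneg (by linarith : 0 ≤ 2 * p - q) (by linarith : 0 ≤ 2 * q - p)]
    have e2 : 3 / 2 ≤ 4 - 2 * (p + q) + p * q := by nlinarith
    have e3 : (p + q) ^ 2 ≤ 3 * ((p * q) * (4 - 2 * (p + q) + p * q)) := by
      nlinarith [mul_le_mul_of_nonneg_left e2 (by nlinarith : 0 ≤ p * q)]
    nlinarith [sq_nonneg (3 * s - (p + q))]
  · have e1 : 0 ≤ ((2 - p - q) - s) * (2 * (p + q) - 3 * (s + (2 - p - q))) :=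
      mul_nonneg (by linarith) (by linarith)
    have e2 : 0 ≤ (1 - p) * (1 - q) := mul_nonneg (by linarith) (by linarith)
    have e3 : 0 ≤ 4 * (2 * ((1 - p) * (1 - q)) + ((1 - p) * (1 - q)) ^ 2) := by positivity
    linear_combination e1 + e3

theorem div_one_add_div {s W : ℝ} (hW : 0 < W) : s ^ 2 / W / (1 + s ^ 2 / W) = s ^ 2 / (s ^ 2 + W) := by
  field_simp
  ring

/-- With `dist x y ^ 2 / W = sinh² (ρ / 2)`, the middle term is `tanh² (ρ / 2)`. Its numerator is
that of the squared `t`-metric, so only denominators are compared. -/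
theorem tMetric_sq_bounds_of_le {X : Type*} [MetricSpace X] {G : Set X} {x y : X} {W : ℝ}
    (hW : 0 < W)
    (hS : 0 < dist x y + infDist x (frontier G) + infDist y (frontier G))
    (h1 : dist x y ^ 2 + W ≤ (dist x y + infDist x (frontier G) + infDist y (frontier G)) ^ 2)
    (h2 : (dist x y + infDist x (frontier G) + infDist y (frontier G)) ^ 2 ≤
      4 * (dist x y ^ 2 + W)) :
    tMetric G x y ^ 2 ≤ dist x y ^ 2 / W / (1 + dist x y ^ 2 / W) ∧
      dist x y ^ 2 / W / (1 + dist x y ^ 2 / W) ≤ 4 * tMetric G x y ^ 2 := by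
  rw [div_one_add_div hW, tMetric, div_pow]
  have hK : 0 < dist x y ^ 2 + W := by positivity
  refine ⟨by gcongr, ?_⟩
  rw [← mul_div_assoc, div_le_div_iff₀ hK (by positivity)]
  nlinarith [mul_le_mul_of_nonneg_left h2 (sq_nonneg (dist x y))]

theorem tMetric_upperHalfSpace_sq_bounds {i : Fin n} (hi : (i : ℕ) + 1 = n) {x y : 𝔼}
    (hx : x ∈ upperHalfSpace n) (hy : y ∈ upperHalfSpace n) :
    tMetric (upperHalfSpace n) x y ^ 2 ≤
        hypRatio (halfWeight i) x y / (1 + hypRatio (halfWeight i) x y) ∧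
      hypRatio (halfWeight i) x y / (1 + hypRatio (halfWeight i) x y) ≤
        4 * tMetric (upperHalfSpace n) x y ^ 2 := by
  have hxi : 0 < x i := hx i hi
  have hyi : 0 < y i := hy i hi
  have hs := PiLp.norm_apply_le (x - y) i
  rw [PiLp.sub_apply, Real.norm_eq_abs, ← dist_eq_norm] at hs
  have hs2 : (x i - y i) ^ 2 ≤ dist x y ^ 2 := sq_le_sq.2 (by rwa [abs_of_nonneg dist_nonneg])
  have h0 : 0 ≤ dist x y := dist_nonneg
  refine tMetric_sq_bounds_of_le (by unfold halfWeight; positivity) ?_ ?_ ?_ <;>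
    rw [infDist_frontier_upperHalfSpace hi hx, infDist_frontier_upperHalfSpace hi hy]
  · positivity
  · unfold halfWeight
    nlinarith [sq_nonneg (x i - y i), mul_nonneg h0 hxi.le, mul_nonneg h0 hyi.le]
  · unfold halfWeight
    nlinarith [sq_nonneg (dist x y - (x i + y i))]

theorem tMetric_unitBall_sq_bounds [Nontrivial 𝔼] {x y : 𝔼}
    (hx : x ∈ unitBall n) (hy : y ∈ unitBall n) :
    tMetric (unitBall n) x y ^ 2 ≤ hypRatio ballWeight x y / (1 + hypRatio ballWeight x y) ∧
      hypRatio ballWeight x y / (1 + hypRatio ballWeight x y) ≤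
        4 * tMetric (unitBall n) x y ^ 2 := by
  have hx1 : ‖x‖ < 1 := mem_ball_zero_iff.1 hx
  have hy1 : ‖y‖ < 1 := mem_ball_zero_iff.1 hy
  have hx0 := norm_nonneg x
  have hy0 := norm_nonneg y
  have h0 : 0 ≤ dist x y := dist_nonneg
  have hxy : ‖x‖ - ‖y‖ ≤ dist x y := dist_eq_norm x y ▸ norm_sub_norm_le x y
  have hyx : ‖y‖ - ‖x‖ ≤ dist x y := by
    rw [dist_comm, dist_eq_norm]; exact norm_sub_norm_le y x
  have hle : dist x y ≤ ‖x‖ + ‖y‖ := dist_eq_norm x y ▸ norm_sub_le x y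
  refine tMetric_sq_bounds_of_le (mul_pos (ballWeight_pos hx) (ballWeight_pos hy)) ?_ ?_ ?_ <;>
    rw [infDist_frontier_unitBall hx, infDist_frontier_unitBall hy]
  · linarith
  · unfold ballWeight
    have hp : 0 < 1 - ‖x‖ := by linarith
    have hq : 0 < 1 - ‖y‖ := by linarith
    have e1 : (1 - ‖x‖ ^ 2) * (1 - ‖y‖ ^ 2) ≤ 4 * ((1 - ‖x‖) * (1 - ‖y‖)) := by
      have : (1 + ‖x‖) * (1 + ‖y‖) ≤ 4 := by nlinarith
      nlinarith [mul_le_mul_of_nonneg_left this (mul_pos hp hq).le]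
    nlinarith [mul_nonneg h0 hp.le, mul_nonneg h0 hq.le, sq_nonneg (‖x‖ - ‖y‖)]
  · unfold ballWeight
    rcases le_total ‖x‖ ‖y‖ with h | h
    · have := add_sq_le_four_mul_of_ball (p := 1 - ‖x‖) (q := 1 - ‖y‖) (s := dist x y)
        (by linarith) (by linarith) (by linarith) (by linarith) (by linarith)
      linear_combination this
    · have := add_sq_le_four_mul_of_ball (p := 1 - ‖y‖) (q := 1 - ‖x‖) (s := dist x y)
        (by linarith) (by linarith) (by linarith) (by linarith) (by linarith)
      linear_combination this

end Models
-- Two-sided bounds for conformal mappings, and existence of the Lipschitz constant.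
section LipschitzConstants

open MeasureTheory Set Filter Topology Metric
open scoped ENNReal

theorem tMetric_nonneg {X : Type*} [MetricSpace X] (G : Set X) (x y : X) : 0 ≤ tMetric G x y :=
  div_nonneg dist_nonneg (add_nonneg (add_nonneg dist_nonneg infDist_nonneg) infDist_nonneg)

/-- The admissible constants form a nonempty closed set bounded below, so their infimum is attained.
-/
theorem exists_isTLipschitzConstant_le {X Y : Type*} [MetricSpace X] [MetricSpace Y]
    {f : X → Y} {G₁ : Set X} {G₂ : Set Y} {C : ℝ} (hC : 0 ≤ C)
    (h : ∀ x ∈ G₁, ∀ y ∈ G₁, tMetric G₂ (f x) (f y) ≤ C * tMetric G₁ x y) :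
    ∃ L : ℝ, IsTLipschitzConstant f G₁ G₂ L ∧ L ≤ C := by
  set S : Set ℝ := {C : ℝ | 0 ≤ C ∧
    ∀ x ∈ G₁, ∀ y ∈ G₁, tMetric G₂ (f x) (f y) ≤ C * tMetric G₁ x y} with hS
  have hbdd : BddBelow S := ⟨0, fun c hc => hc.1⟩
  have hclosed : IsClosed S := by
    simp only [hS, ofPred_and, ofPred_forall]
    exact isClosed_Ici.inter (isClosed_iInter fun x => isClosed_iInter fun _ =>
      isClosed_iInter fun y => isClosed_iInter fun _ =>
        isClosed_le continuous_const (continuous_id.mul continuous_const))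
  exact ⟨sInf S, ⟨hclosed.csInf_mem ⟨C, hC, h⟩ hbdd, fun c hc => csInf_le hbdd hc⟩,
    csInf_le hbdd ⟨hC, h⟩⟩

variable {n : ℕ}

local notation "𝔼" => EuclideanSpace ℝ (Fin n)

theorem exists_hypModel_tMetric_bounds (hn : 2 ≤ n) {G : Set 𝔼}
    (hG : G ∈ ({upperHalfSpace n, unitBall n} : Set (Set 𝔼))) :
    ∃ w : 𝔼 → ℝ, IsHypModel G w ∧ ∀ x ∈ G, ∀ y ∈ G,
      tMetric G x y ^ 2 ≤ hypRatio w x y / (1 + hypRatio w x y) ∧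
      hypRatio w x y / (1 + hypRatio w x y) ≤ 4 * tMetric G x y ^ 2 := by
  obtain ⟨i, hi⟩ : ∃ i : Fin n, (i : ℕ) + 1 = n := ⟨⟨n - 1, by omega⟩, Nat.sub_add_cancel (by omega)⟩
  have : Nonempty (Fin n) := ⟨i⟩
  rcases hG with rfl | rfl
  · exact ⟨_, isHypModel_upperHalfSpace hi,
      fun x hx y hy => tMetric_upperHalfSpace_sq_bounds hi hx hy⟩
  · exact ⟨_, isHypModel_unitBall hi, fun x hx y hy => tMetric_unitBall_sq_bounds hx hy⟩

theorem IsConformalMapping.tMetric_le_two_mul (hn : 2 ≤ n) {G₁ G₂ : Set 𝔼}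
    (hG₁ : G₁ ∈ ({upperHalfSpace n, unitBall n} : Set (Set 𝔼)))
    (hG₂ : G₂ ∈ ({upperHalfSpace n, unitBall n} : Set (Set 𝔼))) {f : 𝔼 → 𝔼}
    (hf : IsConformalMapping f G₁ G₂) {x y : 𝔼} (hx : x ∈ G₁) (hy : y ∈ G₁) :
    tMetric G₂ (f x) (f y) ≤ 2 * tMetric G₁ x y := by
  obtain ⟨w₁, h₁, ht₁⟩ := exists_hypModel_tMetric_bounds hn hG₁
  obtain ⟨w₂, h₂, ht₂⟩ := exists_hypModel_tMetric_bounds hn hG₂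
  have hB : IsHypModel (unitBall n) ballWeight :=
    isHypModel_unitBall (i := ⟨n - 1, by omega⟩) (Nat.sub_add_cancel (by omega))
  have hfx := hf.bijOn.mapsTo hx
  have hfy := hf.bijOn.mapsTo hy
  have hle := hB.hypRatio_le hn h₁ h₂ hf hx hy
  have h0 : 0 ≤ hypRatio w₂ (f x) (f y) :=
    div_nonneg (sq_nonneg _) (mul_pos (h₂.pos _ hfx) (h₂.pos _ hfy)).le
  -- Schwarz–Pick passes from `sinh²` to `tanh²` because `u / (1 + u)` is increasing.
  have hmid : hypRatio w₂ (f x) (f y) / (1 + hypRatio w₂ (f x) (f y)) ≤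
      hypRatio w₁ x y / (1 + hypRatio w₁ x y) := by
    rw [div_le_div_iff₀ (by linarith) (by linarith)]
    nlinarith
  have hsq : tMetric G₂ (f x) (f y) ^ 2 ≤ (2 * tMetric G₁ x y) ^ 2 := by
    rw [mul_pow]
    linarith [(ht₂ _ hfx _ hfy).1, (ht₁ x hx y hy).2]
  exact (pow_le_pow_iff_left₀ (tMetric_nonneg _ _ _)
    (mul_nonneg zero_le_two (tMetric_nonneg _ _ _)) two_ne_zero).1 hsq

theorem IsConformalMapping.tMetric_half_le (hn : 2 ≤ n) {G₁ G₂ : Set 𝔼}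
    (hG₁ : G₁ ∈ ({upperHalfSpace n, unitBall n} : Set (Set 𝔼)))
    (hG₂ : G₂ ∈ ({upperHalfSpace n, unitBall n} : Set (Set 𝔼))) {f : 𝔼 → 𝔼}
    (hf : IsConformalMapping f G₁ G₂) {x y : 𝔼} (hx : x ∈ G₁) (hy : y ∈ G₁) :
    tMetric G₁ x y / 2 ≤ tMetric G₂ (f x) (f y) := by
  obtain ⟨w₁, h₁, -⟩ := exists_hypModel_tMetric_bounds hn hG₁
  have h := (hf.invFunOn h₁.isOpen).tMetric_le_two_mul hn hG₂ hG₁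
    (hf.bijOn.mapsTo hx) (hf.bijOn.mapsTo hy)
  rw [hf.bijOn.invOn_invFunOn.1 hx, hf.bijOn.invOn_invFunOn.1 hy] at h
  linarith

end LipschitzConstants

/-! ### The planar Cayley map and sharpness of the constant `2`. -/

section Cayley

open MeasureTheory Set Filter Topology Metric
open scoped ENNReal

theorem one_add_ne_zero_of_norm_lt_one {z : ℂ} (hz : ‖z‖ < 1) : 1 + z ≠ 0 := by
  intro h
  simp [eq_neg_of_add_eq_zero_right h] at hz

theorem I_add_ne_zero_of_im_pos {w : ℂ} (hw : 0 < w.im) : Complex.I + w ≠ 0 := by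
  intro h
  have := congrArg Complex.im h
  simp at this
  linarith

theorem cayleyComplex_bijOn : BijOn cayleyComplex {z | ‖z‖ < 1} {w | 0 < w.im} := by
  refine InvOn.bijOn (f' := fun w => (Complex.I - w) / (Complex.I + w))
    ⟨fun z hz => ?_, fun w hw => ?_⟩ (fun z hz => ?_) (fun w hw => ?_)
  · have h1 := one_add_ne_zero_of_norm_lt_one hz
    have h2 : Complex.I * (1 + z) + (1 - z) * Complex.I ≠ 0 := by
      have : Complex.I * (1 + z) + (1 - z) * Complex.I = 2 * Complex.I := by ring
      rw [this]; simp
    simp only [cayleyComplex]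
    field_simp
    ring
  · have h1 := I_add_ne_zero_of_im_pos hw
    have h2 : 1 + (Complex.I - w) / (Complex.I + w) ≠ 0 := by
      have : 1 + (Complex.I - w) / (Complex.I + w) = 2 * Complex.I / (Complex.I + w) := by
        field_simp; ring
      rw [this]; simp [h1]
    simp only [cayleyComplex]
    rw [div_eq_iff h2]
    field_simp
    ring
  · have h1 := one_add_ne_zero_of_norm_lt_one hz
    have hz1 : ‖z‖ ^ 2 < 1 := by
      have hz : ‖z‖ < 1 := hz
      nlinarith [norm_nonneg z]
    rw [Complex.sq_norm, Complex.normSq_apply] at hz1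
    have h2 := Complex.normSq_pos.2 h1
    have h3 : (cayleyComplex z).im = (1 - (z.re * z.re + z.im * z.im)) / Complex.normSq (1 + z) := by
      rw [cayleyComplex, Complex.div_im]
      simp
      field_simp
      ring
    show 0 < (cayleyComplex z).im
    rw [h3]
    exact div_pos (by linarith) h2
  · have hw : 0 < w.im := hw
    have h1 := I_add_ne_zero_of_im_pos hw
    show ‖(Complex.I - w) / (Complex.I + w)‖ < 1
    rw [norm_div, div_lt_one (norm_pos_iff.2 h1), ← pow_lt_pow_iff_left₀ (norm_nonneg _)
      (norm_nonneg _) two_ne_zero, Complex.sq_norm, Complex.sq_norm, Complex.normSq_apply,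
      Complex.normSq_apply]
    simp
    nlinarith

/-- The isometric identification of `ℂ` with the Euclidean plane. -/
noncomputable def complexEuclidean : ℂ ≃ₗᵢ[ℝ] EuclideanSpace ℝ (Fin 2) :=
  Complex.orthonormalBasisOneI.repr

theorem complexEuclidean_apply (z : ℂ) : complexEuclidean z = !₂[z.re, z.im] := by
  ext i
  fin_cases i <;> simp [complexEuclidean, Complex.orthonormalBasisOneI_repr_apply]

theorem complexEuclidean_symm_apply (x : EuclideanSpace ℝ (Fin 2)) :
    complexEuclidean.symm x = ⟨x 0, x 1⟩ := by
  rw [LinearIsometryEquiv.symm_apply_eq, complexEuclidean_apply]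
  ext i
  fin_cases i <;> simp

theorem cayleyMap_eq_comp :
    cayleyMap = complexEuclidean ∘ cayleyComplex ∘ complexEuclidean.symm := by
  funext x
  simp only [Function.comp_apply, complexEuclidean_apply, complexEuclidean_symm_apply, cayleyMap]

theorem isConformalMapping_cayleyMap :
    IsConformalMapping cayleyMap (unitBall 2) (upperHalfSpace 2) := by
  have hball : ∀ x ∈ unitBall 2, ‖complexEuclidean.symm x‖ < 1 := fun x hx => by
    rw [LinearIsometryEquiv.norm_map]; exact mem_ball_zero_iff.1 hx
  have hsmooth : ∀ z : ℂ, ‖z‖ < 1 → ContDiffAt ℝ 1 cayleyComplex z := fun z hz => by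
    have h : ContDiffAt ℂ 1 cayleyComplex z :=
      ((contDiffAt_const.sub contDiffAt_id).mul contDiffAt_const).div
        (contDiffAt_const.add contDiffAt_id) (one_add_ne_zero_of_norm_lt_one hz)
    exact h.restrict_scalars ℝ
  have hconf : ∀ z : ℂ, ‖z‖ < 1 → ConformalAt cayleyComplex z := fun z hz => by
    have h1 := one_add_ne_zero_of_norm_lt_one hz
    have hd : HasDerivAt cayleyComplex (-2 * Complex.I / (1 + z) ^ 2) z := by
      have := (((hasDerivAt_id z).const_sub 1).mul_const Complex.I).div
        ((hasDerivAt_id z).const_add 1) h1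
      refine this.congr_deriv ?_
      simp only [id]
      ring
    refine hd.differentiableAt.conformalAt ?_
    rw [hd.deriv]
    simp [h1]
  have hiso : ∀ x, ConformalAt complexEuclidean x := fun x =>
    ⟨_, complexEuclidean.toContinuousLinearEquiv.hasFDerivAt,
      complexEuclidean.toLinearIsometry.isConformalMap⟩
  have hiso' : ∀ x, ConformalAt complexEuclidean.symm x := fun x =>
    ⟨_, complexEuclidean.symm.toContinuousLinearEquiv.hasFDerivAt,
      complexEuclidean.symm.toLinearIsometry.isConformalMap⟩
  rw [cayleyMap_eq_comp]
  refine ⟨fun x hx => ContDiffAt.contDiffWithinAt ?_, fun x hx => ?_, ?_⟩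
  · exact complexEuclidean.contDiff.contDiffAt.comp x
      ((hsmooth _ (hball x hx)).comp x complexEuclidean.symm.contDiff.contDiffAt)
  · exact (hiso _).comp x ((hconf _ (hball x hx)).comp x (hiso' x))
  · have e1 : BijOn complexEuclidean.symm (unitBall 2) {z | ‖z‖ < 1} := by
      refine InvOn.bijOn (f' := complexEuclidean) ⟨fun x _ => by simp, fun x _ => by simp⟩ hball
        fun z hz => ?_
      rw [unitBall, mem_ball_zero_iff, LinearIsometryEquiv.norm_map]
      exact hz
    have e2 : BijOn complexEuclidean {w | 0 < w.im} (upperHalfSpace 2) := by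
      rw [upperHalfSpace_eq (i := (1 : Fin 2)) rfl]
      refine InvOn.bijOn (f' := complexEuclidean.symm) ⟨fun x _ => by simp, fun x _ => by simp⟩
        (fun z hz => ?_) fun x hx => ?_
      · have hz : 0 < z.im := hz
        rw [complexEuclidean_apply]
        simpa using hz
      · rw [complexEuclidean_symm_apply]
        exact hx
    exact e2.comp (cayleyComplex_bijOn.comp e1)

theorem cayleyMap_real (y : ℝ) : cayleyMap !₂[y, 0] = !₂[0, (1 - y) / (1 + y)] := by
  have : cayleyComplex ⟨y, 0⟩ = ((1 - y) / (1 + y) : ℝ) * Complex.I := by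
    have h : (⟨y, 0⟩ : ℂ) = (y : ℂ) := rfl
    rw [cayleyComplex, h]
    push_cast
    ring
  simp only [cayleyMap]
  rw [show (⟨(!₂[y, 0] : EuclideanSpace ℝ (Fin 2)) 0, (!₂[y, 0] : EuclideanSpace ℝ (Fin 2)) 1⟩ : ℂ)
    = ⟨y, 0⟩ by simp, this, Complex.re_ofReal_mul, Complex.im_ofReal_mul]
  simp

theorem tMetric_unitBall_zero {y : ℝ} (hy0 : 0 ≤ y) (hy1 : y < 1) :
    tMetric (unitBall 2) !₂[0, 0] !₂[y, 0] = y / 2 := by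
  have hn : ‖(!₂[y, 0] : EuclideanSpace ℝ (Fin 2))‖ = y := by
    simp [EuclideanSpace.norm_eq, Real.sqrt_sq hy0]
  have h0 : (!₂[0, 0] : EuclideanSpace ℝ (Fin 2)) = 0 := by
    ext i; fin_cases i <;> simp
  rw [tMetric, h0, infDist_frontier_unitBall zero_mem_unitBall,
    infDist_frontier_unitBall (mem_ball_zero_iff.2 (hn.trans_lt hy1)), dist_zero_left, hn, norm_zero]
  congr 1
  ring

theorem tMetric_upperHalfSpace_vertical {a b : ℝ} (ha : 0 < a) (hb : 0 < b) :
    tMetric (upperHalfSpace 2) !₂[0, a] !₂[0, b] = |a - b| / (|a - b| + a + b) := by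
  have hmem : ∀ c : ℝ, 0 < c → !₂[0, c] ∈ upperHalfSpace 2 := fun c hc => by
    rw [upperHalfSpace_eq (i := (1 : Fin 2)) rfl]
    simpa using hc
  rw [tMetric, infDist_frontier_upperHalfSpace (i := (1 : Fin 2)) rfl (hmem a ha),
    infDist_frontier_upperHalfSpace (i := (1 : Fin 2)) rfl (hmem b hb)]
  simp [EuclideanSpace.dist_eq, Real.dist_eq, Real.sqrt_sq_eq_abs]

/-- For the pair `0, y` on the real axis the `t`-distance grows from `y / 2` to `y / (1 + y)`, and
the ratio `2 / (1 + y)` tends to `2` as `y → 0+`. -/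
theorem isTLipschitzConstant_cayleyMap :
    IsTLipschitzConstant cayleyMap (unitBall 2) (upperHalfSpace 2) 2 := by
  refine ⟨⟨zero_le_two, fun x hx y hy =>
    isConformalMapping_cayleyMap.tMetric_le_two_mul le_rfl (by simp) (by simp) hx hy⟩, ?_⟩
  rintro C ⟨hC0, hC⟩
  by_contra! hlt
  -- Small enough that `C * (1 + y) < 2`: the gap is `(2 - C) * (1 - C / 4)`.
  set y : ℝ := (2 - C) / 4 with hy
  have hy0 : 0 < y := by rw [hy]; linarith
  have hy1 : y < 1 := by rw [hy]; linarith
  have hmem : ∀ t : ℝ, 0 ≤ t → t < 1 → !₂[t, 0] ∈ unitBall 2 := fun t h0 h1 => by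
    rw [unitBall, mem_ball_zero_iff]
    simpa [EuclideanSpace.norm_eq, Real.sqrt_sq h0] using h1
  have h := hC _ (hmem 0 le_rfl one_pos) _ (hmem y hy0.le hy1)
  have hp : 0 < (1 - y) / (1 + y) := div_pos (by linarith) (by linarith)
  rw [cayleyMap_real, cayleyMap_real, tMetric_unitBall_zero hy0.le hy1,
    tMetric_upperHalfSpace_vertical (by norm_num) hp] at h
  have e1 : (1 - 0) / (1 + 0) - (1 - y) / (1 + y) = 2 * y / (1 + y) := by
    have : 1 + y ≠ 0 := by positivity
    field_simp; ring
  have e2 : 2 * y / (1 + y) / (2 * y / (1 + y) + (1 - 0) / (1 + 0) + (1 - y) / (1 + y)) =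
      y / (1 + y) := by
    have : 1 + y ≠ 0 := by positivity
    have e3 : 2 * y / (1 + y) + (1 - 0) / (1 + 0) + (1 - y) / (1 + y) = 2 := by field_simp; ring
    rw [e3]; ring
  rw [e1, abs_of_pos (by positivity), e2, div_le_iff₀ (by positivity)] at h
  have h' : 2 ≤ C * (1 + y) := by
    have : y * 2 ≤ y * (C * (1 + y)) := by linarith
    exact le_of_mul_le_mul_left this hy0
  nlinarith

end Cayley

theorem theorem4p5 :
    (∀ n : ℕ, 2 ≤ n →
      ∀ G₁ ∈ ({upperHalfSpace n, unitBall n} : Set (Set (EuclideanSpace ℝ (Fin n)))),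
      ∀ G₂ ∈ ({upperHalfSpace n, unitBall n} : Set (Set (EuclideanSpace ℝ (Fin n)))),
      ∀ f : EuclideanSpace ℝ (Fin n) → EuclideanSpace ℝ (Fin n),
        IsConformalMapping f G₁ G₂ →
          (∀ x ∈ G₁, ∀ y ∈ G₁,
            tMetric G₁ x y / 2 ≤ tMetric G₂ (f x) (f y) ∧
            tMetric G₂ (f x) (f y) ≤ 2 * tMetric G₁ x y) ∧
          ∃ L : ℝ, IsTLipschitzConstant f G₁ G₂ L ∧ L ≤ 2) ∧
    IsConformalMapping cayleyMap (unitBall 2) (upperHalfSpace 2) ∧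
    IsTLipschitzConstant cayleyMap (unitBall 2) (upperHalfSpace 2) 2 := by
  refine ⟨fun n hn G₁ hG₁ G₂ hG₂ f hf => ?_, isConformalMapping_cayleyMap,
    isTLipschitzConstant_cayleyMap⟩
  have h := fun x hx y hy => hf.tMetric_le_two_mul hn hG₁ hG₂ (x := x) (y := y) hx hy
  exact ⟨fun x hx y hy => ⟨hf.tMetric_half_le hn hG₁ hG₂ hx hy, h x hx y hy⟩,
    exists_isTLipschitzConstant_le zero_le_two h⟩
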